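/- For $1\le p\le\infty$ let $\|\cdot\|_p$ be the norm of the space $L_p$ of real $2\pi$-periodic functions, $\|\varphi\|_p=\big(\int_{-\pi}^{\pi}|\varphi(t)|^p\,dt\big)^{1/p}$ for $p<\infty$ and $\|\varphi\|_\infty=\operatorname{ess\,sup}|\varphi|$. For $r>1$ and $\beta\in\mathbb R$ let $B_{r,\beta}(t)=\sum_{k=1}^{\infty}k^{-r}\cos\big(kt-\tfrac{\beta\pi}{2}\big)$, and let the Weyl–Nagy class $W^r_{\beta,p}$ consist of all $2\pi$-periodic functions $$f(x)=\frac{a_0}{2}+\frac1\pi\int_{-\pi}^{\pi}\varphi(x-t)\,B_{r,\beta}(t)\,dt,\qquad a_0\in\mathbb R,\quad \varphi\in L_p,\quad \|\varphi\|_p\le 1,\quad \int_{-\pi}^{\pi}\varphi(t)\,dt=0 .$$ Let ${\cal E}_n(W^r_{\beta,p})_C=\sup_{f\in W^r_{\beta,p}}\max_x|f(x)-S_{n-1}(f;x)|$, where $S_{n-1}(f;\cdot)$ is the partial Fourier sum of $f$ of order $n-1$. **Theorem 1.** There is an absolute constant $K$ such that the following holds for all $1\le p\le\infty$, $\beta\in\mathbb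 R$, $r>1$ and integers $n\ge1$ with $\sqrt n+1\le r\le n+1$, where $\frac1p+\frac1{p'}=1$. The functions in $W^r_{\beta,p}$ are continuous, ${\cal E}_n(W^r_{\beta,p})_C$ is finite, and there is a real number $\theta$ with $|\theta|\le K$ such that, if $p=1$, $${\cal E}_n(W^r_{\beta,1})_C=n^{-r}\Big(\frac{1}{\pi\,(1-e^{-r/n})}+\theta\,n\,r^{-2}\Big),$$ and, if $1<p\le\infty$, $${\cal E}_n(W^r_{\beta,p})_C=n^{-r}\Big(\frac{\|\cos t\|_{p'}}{\pi}\,F^{1/p'}\Big(\frac{p'}{2},\frac{p'}{2};1;e^{-2r/n}\Big)+\theta\,n\,r^{-2}\Big).$$ Here $F(a,b;c;z)=1+\sum_{k=1}^{\infty}\frac{(a)_k(b)_k}{(c)_k}\frac{z^k}{k!}$, with $(x)_k=x(x+1)\cdots(x+k-1)$, is the Gauss hypergeometric function. -/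

import Mathlib

open MeasureTheory
open scoped ENNReal

noncomputable section

namespace WeylNagy

/-- The Weyl–Nagy kernel `B_{r,β}(t) = ∑_{k ≥ 1} k^{-r} cos (k t - β π / 2)`. -/
def kernel (r β t : ℝ) : ℝ :=
  ∑' k : ℕ, ((k + 1 : ℕ) : ℝ) ^ (-r) * Real.cos (((k + 1 : ℕ) : ℝ) * t - β * Real.pi / 2)

/-- The (unnormalized) norm of `L_p` over one period, with values in `[0, ∞]`. -/
def periodNorm (p : ℝ≥0∞) (φ : ℝ → ℝ) : ℝ≥0∞ :=
  eLpNorm φ p (volume.restrict (Set.Ico (-Real.pi) Real.pi))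

/-- `B_p^0`: the `2π`-periodic functions of `L_p` with norm at most one and mean value zero. -/
def unitBall (p : ℝ≥0∞) : Set (ℝ → ℝ) :=
  {φ | Function.Periodic φ (2 * Real.pi) ∧
    MemLp φ p (volume.restrict (Set.Ico (-Real.pi) Real.pi)) ∧
    periodNorm p φ ≤ 1 ∧
    ∫ t in (-Real.pi)..Real.pi, φ t = 0}

/-- The Weyl–Nagy class `W^r_{β,p}`: the `2π`-periodic functions
`f(x) = a₀ / 2 + (1 / π) ∫_{-π}^{π} φ(x - t) B_{r,β}(t) dt` with `a₀` real and `φ` in `B_p^0`. -/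
def weylNagyClass (r β : ℝ) (p : ℝ≥0∞) : Set (ℝ → ℝ) :=
  {f | Function.Periodic f (2 * Real.pi) ∧
    ∃ a₀ : ℝ, ∃ φ ∈ unitBall p, ∀ x : ℝ,
      f x = a₀ / 2 + (1 / Real.pi) * ∫ t in (-Real.pi)..Real.pi, φ (x - t) * kernel r β t}

/-- The cosine Fourier coefficient `a_k(f)`. -/
def cosCoeff (f : ℝ → ℝ) (k : ℕ) : ℝ :=
  (1 / Real.pi) * ∫ t in (-Real.pi)..Real.pi, f t * Real.cos (k * t)

/-- The sine Fourier coefficient `b_k(f)`. -/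
def sinCoeff (f : ℝ → ℝ) (k : ℕ) : ℝ :=
  (1 / Real.pi) * ∫ t in (-Real.pi)..Real.pi, f t * Real.sin (k * t)

/-- The partial Fourier sum of `f` of order `m`. -/
def fourierSum (m : ℕ) (f : ℝ → ℝ) (x : ℝ) : ℝ :=
  cosCoeff f 0 / 2 +
    ∑ k ∈ Finset.Icc 1 m, (cosCoeff f k * Real.cos (k * x) + sinCoeff f k * Real.sin (k * x))

/-- The uniform norm, with values in `[0, ∞]`. -/
def uniformNorm (g : ℝ → ℝ) : ℝ≥0∞ := ⨆ x : ℝ, ‖g x‖ₑ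

/-- `E_n(N)_C`: the least upper bound over `f` in `N` of the uniform norm of the deviation of `f`
from its Fourier sum of order `n - 1`, with values in `[0, ∞]`. -/
def fourierError (n : ℕ) (N : Set (ℝ → ℝ)) : ℝ≥0∞ :=
  ⨆ f ∈ N, uniformNorm (fun x => f x - fourierSum (n - 1) f x)

/-- The factor in brackets without the remainder, for an exponent `p > 1` with conjugate
exponent `p'`; here `F` is the Gauss hypergeometric function. -/
def mainTerm (p' : ℝ≥0∞) (r : ℝ) (n : ℕ) : ℝ :=
  (periodNorm p' Real.cos).toReal / Real.pi *
    (ordinaryHypergeometric (p'.toReal / 2) (p'.toReal / 2) (1 : ℝ)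
      (Real.exp (-2 * r / n))) ^ (1 / p'.toReal)

end WeylNagy

end

/-! Only harmonics of order at least `n` survive in `f - S_{n-1} f`, so the deviation is `1/π` times
the convolution of `φ` with the tail `B` of the kernel. Hölder's inequality bounds the error by
`‖B‖_{p'} / π`. The mean-zero condition may exclude the Hölder extremizer `φ₀`, but `(φ₀ - φ₀(· -
δ)) / 2` always has mean zero and norm at most one; it gives the lower bound `‖B - B(· + δ)‖_{p'} /
(2π)`, up to an arbitrarily small loss (`fourierError_bounds`).

After multiplication by `n^r` the weights of the tail are `(1 + k/n)^{-r}`. They differ from `q^k`,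
`q = e^{-r/n}`, by a total of `O(n/r²)`, so `n^r B` is uniformly close to `Re (e^{i(nt+τ)} / (1 - q
e^{it}))`: a slowly varying amplitude times a fast oscillation
(`abs_tailKernel_sub_poissonKernel_le`). Translating this kernel by `σ` is therefore the same as
advancing the phase by `nσ`, up to `|σ| / (1-q)²`. This is used twice. With `δ = π/n` the
translation flips the sign, so the upper and lower bounds meet. And any phase is reached by some
`|σ| ≤ π/n`, so the norm is independent of the phase up to `O(1 / (n(1-q)²))`, which is `O(n/r²)`
because `r ≤ n + 1`.

Near-independence of the phase makes the norm computable. For finite `s = p'`, the integral over `τ`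
of its `s`-th power factors exactly into `∫ |cos|^s` times `∫ |1 - q e^{it}|^{-s}`, and Parseval's
identity for the binomial series of `(1-z)^{-s/2}` evaluates the second factor as `2π F(s/2, s/2; 1;
q²)`. For `s = ∞` one phase is exhibited for which the kernel takes its largest possible value
`1/(1-q)` at the origin. All approximations are uniform in `t`, and passing from the sup norm to
`L_s` costs at most `2π`; hence the constant does not depend on `p`. -/

noncomputable section

namespace WeylNagy

/-! ### Integration over a period: translations and reflections -/

/-- Lebesgue measure on one period. -/
def periodMeasure : Measure ℝ := volume.restrict (Set.Ico (-Real.pi) Real.pi)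

instance : IsFiniteMeasure periodMeasure := by
  unfold periodMeasure; infer_instance

lemma periodMeasure_univ : periodMeasure Set.univ = ENNReal.ofReal (2 * Real.pi) := by
  rw [periodMeasure, Measure.restrict_apply_univ, Real.volume_Ico]; ring_nf

lemma periodMeasure_real_univ : periodMeasure.real Set.univ = 2 * Real.pi := by
  rw [measureReal_def, periodMeasure_univ, ENNReal.toReal_ofReal (by positivity)]

lemma periodNorm_eq (p : ℝ≥0∞) (φ : ℝ → ℝ) : periodNorm p φ = eLpNorm φ p periodMeasure := rfl

lemma periodMeasure_eq_Ioc :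
    periodMeasure = volume.restrict (Set.Ioc (-Real.pi) Real.pi) :=
  Measure.restrict_congr_set Ico_ae_eq_Ioc

lemma intervalIntegral_eq_periodMeasure {E : Type*} [NormedAddCommGroup E] [NormedSpace ℝ E]
    (f : ℝ → E) : ∫ t in (-Real.pi)..Real.pi, f t = ∫ t, f t ∂periodMeasure := by
  rw [intervalIntegral.integral_of_le (by linarith [Real.pi_pos]), periodMeasure_eq_Ioc]

lemma isAddFundamentalDomain_period (a : ℝ) :
    IsAddFundamentalDomain (AddSubgroup.zmultiples (2 * Real.pi))
      (Set.Ioc a (a + 2 * Real.pi)) volume :=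
  isAddFundamentalDomain_Ioc Real.two_pi_pos a

lemma periodMeasure_eq_Ioc' :
    periodMeasure = volume.restrict (Set.Ioc (-Real.pi) (-Real.pi + 2 * Real.pi)) := by
  rw [periodMeasure_eq_Ioc]; ring_nf

/-- Reflection exchanges the closed and open ends, which is why the half-open window changes from
`Ico` to `Ioc`. -/
lemma measurePreserving_reflect (c : ℝ) :
    MeasurePreserving (fun t : ℝ => c - t) periodMeasure
      (volume.restrict (Set.Ioc (-Real.pi + c) (-Real.pi + c + 2 * Real.pi))) := by
  have h : MeasurePreserving (fun t : ℝ => c - t) volume volume :=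
    Measure.measurePreserving_sub_left volume c
  have h2 := h.restrict_preimage
    (s := Set.Ioc (-Real.pi + c) (-Real.pi + c + 2 * Real.pi)) measurableSet_Ioc
  have h3 : (fun t : ℝ => c - t) ⁻¹' Set.Ioc (-Real.pi + c) (-Real.pi + c + 2 * Real.pi)
      = Set.Ico (-Real.pi) Real.pi := by
    ext t; simp only [Set.mem_preimage, Set.mem_Ioc, Set.mem_Ico]
    constructor <;> rintro ⟨h1, h2⟩ <;> constructor <;> linarith
  rw [h3] at h2
  exact h2

lemma aestronglyMeasurable_shift_domain {φ : ℝ → ℝ} (hφ : Function.Periodic φ (2 * Real.pi))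
    (hm : AEStronglyMeasurable φ periodMeasure) (a : ℝ) :
    AEStronglyMeasurable φ (volume.restrict (Set.Ioc a (a + 2 * Real.pi))) := by
  rw [periodMeasure_eq_Ioc'] at hm
  exact ((isAddFundamentalDomain_period _).aestronglyMeasurable_on_iff
    (isAddFundamentalDomain_period a) hφ.map_vadd_zmultiples).1 hm

/-- Both windows are fundamental domains of `2πℤ`, and a periodic function is invariant under this
group. The exponent `⊤` needs the essential supremum version of that principle. -/
lemma eLpNorm_shift_domain {φ : ℝ → ℝ} (hφ : Function.Periodic φ (2 * Real.pi)) (p : ℝ≥0∞)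
    (a : ℝ) :
    eLpNorm φ p (volume.restrict (Set.Ioc a (a + 2 * Real.pi))) = periodNorm p φ := by
  have key : ∀ F : ℝ → ℝ≥0∞, (∀ (g : AddSubgroup.zmultiples (2 * Real.pi)) (x : ℝ),
      F (g +ᵥ x) = F x) → ∫⁻ x in Set.Ioc a (a + 2 * Real.pi), F x = ∫⁻ x, F x ∂periodMeasure := by
    intro F hF
    rw [periodMeasure_eq_Ioc']
    exact (isAddFundamentalDomain_period a).setLIntegral_eq (isAddFundamentalDomain_period _) F hF
  rw [periodNorm_eq]
  rcases eq_or_ne p 0 with rfl | h0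
  · simp
  rcases eq_or_ne p ⊤ with rfl | ht
  · rw [eLpNorm_exponent_top, eLpNorm_exponent_top, eLpNormEssSup, eLpNormEssSup,
      periodMeasure_eq_Ioc']
    have hF : ∀ (g : AddSubgroup.zmultiples (2 * Real.pi)) (x : ℝ),
      ‖φ (g +ᵥ x)‖ₑ = ‖φ x‖ₑ := fun g x => by rw [hφ.map_vadd_zmultiples]
    rw [(isAddFundamentalDomain_period a).essSup_measure_restrict hF,
      (isAddFundamentalDomain_period _).essSup_measure_restrict hF]
  · rw [eLpNorm_eq_lintegral_rpow_enorm_toReal h0 ht, eLpNorm_eq_lintegral_rpow_enorm_toReal h0 ht,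
      key]
    intro g x; rw [hφ.map_vadd_zmultiples]

lemma aestronglyMeasurable_reflect {φ : ℝ → ℝ} (hφ : Function.Periodic φ (2 * Real.pi))
    (hm : AEStronglyMeasurable φ periodMeasure) (c : ℝ) :
    AEStronglyMeasurable (fun t => φ (c - t)) periodMeasure :=
  (aestronglyMeasurable_shift_domain hφ hm (-Real.pi + c)).comp_measurePreserving
    (measurePreserving_reflect c)

lemma periodNorm_reflect {φ : ℝ → ℝ} (hφ : Function.Periodic φ (2 * Real.pi))
    (hm : AEStronglyMeasurable φ periodMeasure) (p : ℝ≥0∞) (c : ℝ) :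
    periodNorm p (fun t => φ (c - t)) = periodNorm p φ := by
  rw [← eLpNorm_shift_domain hφ p (-Real.pi + c)]
  exact eLpNorm_comp_measurePreserving
    (aestronglyMeasurable_shift_domain hφ hm (-Real.pi + c)) (measurePreserving_reflect c)

lemma periodic_reflect {E : Type*} {φ : ℝ → E} (hφ : Function.Periodic φ (2 * Real.pi)) (c : ℝ) :
    Function.Periodic (fun t => φ (c - t)) (2 * Real.pi) := by
  intro t
  change φ (c - (t + 2 * Real.pi)) = φ (c - t)
  rw [← hφ (c - (t + 2 * Real.pi))]; ring_nf

lemma periodic_shift {E : Type*} {φ : ℝ → E} (hφ : Function.Periodic φ (2 * Real.pi)) (c : ℝ) :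
    Function.Periodic (fun t => φ (t + c)) (2 * Real.pi) := by
  intro t
  change φ (t + 2 * Real.pi + c) = φ (t + c)
  rw [← hφ (t + c)]; ring_nf

/-- A translation is a composition of two reflections. -/
lemma periodNorm_shift {φ : ℝ → ℝ} (hφ : Function.Periodic φ (2 * Real.pi))
    (hm : AEStronglyMeasurable φ periodMeasure) (p : ℝ≥0∞) (c : ℝ) :
    periodNorm p (fun t => φ (t + c)) = periodNorm p φ := by
  rw [← periodNorm_reflect hφ hm p 0, ← periodNorm_reflect (periodic_reflect hφ 0)
    (aestronglyMeasurable_reflect hφ hm 0) p (-c)]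
  congr 1; ext t; ring_nf

lemma integral_reflect {E : Type*} [NormedAddCommGroup E] [NormedSpace ℝ E] {φ : ℝ → E}
    (hφ : Function.Periodic φ (2 * Real.pi)) (c : ℝ) :
    ∫ t, φ (c - t) ∂periodMeasure = ∫ t, φ t ∂periodMeasure := by
  rw [← intervalIntegral_eq_periodMeasure, ← intervalIntegral_eq_periodMeasure,
    intervalIntegral.integral_comp_sub_left]
  have := hφ.intervalIntegral_add_eq (c - Real.pi) (-Real.pi)
  convert this using 2 <;> ring

lemma integral_shift {E : Type*} [NormedAddCommGroup E] [NormedSpace ℝ E] {φ : ℝ → E}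
    (hφ : Function.Periodic φ (2 * Real.pi)) (c : ℝ) :
    ∫ t, φ (t + c) ∂periodMeasure = ∫ t, φ t ∂periodMeasure := by
  rw [← integral_reflect hφ 0, ← integral_reflect (periodic_reflect hφ 0) (-c)]
  congr 1; ext t; ring_nf

/-! ### Norms of continuous functions, with constants uniform in the exponent -/

lemma memLp_of_continuous {h : ℝ → ℝ} (hh : Continuous h) (p : ℝ≥0∞) :
    MemLp h p periodMeasure := by
  obtain ⟨C, hC⟩ := (isCompact_Icc (a := -Real.pi) (b := Real.pi)).exists_bound_of_continuousOn
    hh.continuousOn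
  refine MemLp.of_bound hh.aestronglyMeasurable C ?_
  unfold periodMeasure
  filter_upwards [ae_restrict_mem measurableSet_Ico] with t ht
  exact hC t ⟨ht.1, ht.2.le⟩

lemma integrable_of_continuous {E : Type*} [NormedAddCommGroup E] {h : ℝ → E}
    (hh : Continuous h) : Integrable h periodMeasure := by
  rw [periodMeasure_eq_Ioc]
  exact (hh.integrableOn_Icc (a := -Real.pi) (b := Real.pi)).mono_set Set.Ioc_subset_Icc_self

lemma periodNorm_ne_top {h : ℝ → ℝ} (hh : Continuous h) (p : ℝ≥0∞) : periodNorm p h ≠ ⊤ :=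
  (memLp_of_continuous hh p).2.ne

/-- The base exceeds one, so `p = 1` is the worst case; this keeps later constants free of `p`. -/
lemma two_pi_rpow_le {p : ℝ≥0∞} (hp : 1 ≤ p) :
    ENNReal.ofReal (2 * Real.pi) ^ p.toReal⁻¹ ≤ ENNReal.ofReal (2 * Real.pi) := by
  have h1 : (1 : ℝ≥0∞) ≤ ENNReal.ofReal (2 * Real.pi) := by
    rw [ENNReal.one_le_ofReal]; linarith [Real.pi_gt_three]
  have h2 : p.toReal⁻¹ ≤ 1 := by
    rcases eq_or_ne p ⊤ with rfl | ht
    · simp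
    · apply inv_le_one_of_one_le₀
      rw [← ENNReal.toReal_one]
      exact ENNReal.toReal_mono ht hp
  calc _ ≤ ENNReal.ofReal (2 * Real.pi) ^ (1 : ℝ) := ENNReal.rpow_le_rpow_of_exponent_le h1 h2
    _ = _ := by simp

/-- On one period the `L_p` norm is at most `2π` times a uniform bound. -/
lemma periodNorm_le_of_bound {p : ℝ≥0∞} (hp : 1 ≤ p) {h : ℝ → ℝ} {C : ℝ}
    (hb : ∀ t, |h t| ≤ C) : periodNorm p h ≤ ENNReal.ofReal (2 * Real.pi * C) := by
  rw [periodNorm_eq]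
  refine (eLpNorm_le_of_ae_bound (C := C) (Filter.Eventually.of_forall hb)).trans ?_
  rw [periodMeasure_univ, ENNReal.ofReal_mul (p := 2 * Real.pi) (by positivity)]
  exact mul_le_mul' (two_pi_rpow_le hp) le_rfl

/-- The `L_p` norm over one period as a real number. -/
def realNorm (p : ℝ≥0∞) (h : ℝ → ℝ) : ℝ := (periodNorm p h).toReal

lemma realNorm_nonneg (p : ℝ≥0∞) (h : ℝ → ℝ) : 0 ≤ realNorm p h := ENNReal.toReal_nonneg

lemma realNorm_le_add {p : ℝ≥0∞} (hp : 1 ≤ p) {h₁ h₂ : ℝ → ℝ} (c₁ : Continuous h₁)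
    (c₂ : Continuous h₂) {ε : ℝ} (hε : ∀ t, |h₁ t - h₂ t| ≤ ε) :
    realNorm p h₁ ≤ realNorm p h₂ + 2 * Real.pi * ε := by
  have h0 : 0 ≤ ε := (abs_nonneg _).trans (hε 0)
  have hle : periodNorm p h₁ ≤ periodNorm p h₂ + ENNReal.ofReal (2 * Real.pi * ε) := by
    calc periodNorm p h₁ = eLpNorm (h₂ + (h₁ - h₂)) p periodMeasure := by
          rw [periodNorm_eq]; congr 1; ext t; simp
      _ ≤ eLpNorm h₂ p periodMeasure + eLpNorm (h₁ - h₂) p periodMeasure :=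
          eLpNorm_add_le c₂.aestronglyMeasurable (c₁.sub c₂).aestronglyMeasurable hp
      _ ≤ _ := by
          gcongr
          · exact le_rfl
          · exact periodNorm_le_of_bound hp hε
  have := ENNReal.toReal_mono
    (ENNReal.add_ne_top.2 ⟨periodNorm_ne_top c₂ p, ENNReal.ofReal_ne_top⟩) hle
  rwa [ENNReal.toReal_add (periodNorm_ne_top c₂ p) ENNReal.ofReal_ne_top,
    ENNReal.toReal_ofReal (by positivity)] at this

lemma abs_realNorm_sub_le {p : ℝ≥0∞} (hp : 1 ≤ p) {h₁ h₂ : ℝ → ℝ} (c₁ : Continuous h₁)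
    (c₂ : Continuous h₂) {ε : ℝ} (hε : ∀ t, |h₁ t - h₂ t| ≤ ε) :
    |realNorm p h₁ - realNorm p h₂| ≤ 2 * Real.pi * ε := by
  have h1 := realNorm_le_add hp c₁ c₂ hε
  have h2 := realNorm_le_add hp c₂ c₁ (fun t => (abs_sub_comm _ _).trans_le (hε t))
  rw [abs_le]; constructor <;> linarith

lemma realNorm_const_mul (p : ℝ≥0∞) (c : ℝ) (h : ℝ → ℝ) :
    realNorm p (fun t => c * h t) = |c| * realNorm p h := by
  unfold realNorm
  rw [periodNorm_eq, show (fun t => c * h t) = c • h from rfl, eLpNorm_const_smul,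
    ENNReal.toReal_mul, periodNorm_eq]
  simp

lemma realNorm_shift {h : ℝ → ℝ} (hp : Function.Periodic h (2 * Real.pi)) (hc : Continuous h)
    (p : ℝ≥0∞) (c : ℝ) : realNorm p (fun t => h (t + c)) = realNorm p h := by
  unfold realNorm
  rw [periodNorm_shift hp hc.aestronglyMeasurable]

/-! ### Orthogonality and Fourier coefficients of absolutely convergent series -/

lemma integral_cos_int_mul {m : ℤ} (hm : m ≠ 0) :
    ∫ t, Real.cos (m * t) ∂periodMeasure = 0 := by
  rw [← intervalIntegral_eq_periodMeasure,
    intervalIntegral.integral_comp_mul_left (fun t => Real.cos t) (Int.cast_ne_zero.2 hm),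
    integral_cos, mul_neg, Real.sin_neg, Real.sin_int_mul_pi]
  simp

lemma integral_sin_mul (m : ℝ) : ∫ t, Real.sin (m * t) ∂periodMeasure = 0 := by
  rw [← intervalIntegral_eq_periodMeasure]
  rcases eq_or_ne m 0 with rfl | hm
  · simp
  rw [intervalIntegral.integral_comp_mul_left (fun t => Real.sin t) hm, integral_sin, mul_neg,
    Real.cos_neg]
  simp

lemma integral_cos_mul_cos {k : ℕ} (hk : k ≠ 0) (j : ℕ) :
    ∫ t, Real.cos (k * t) * Real.cos (j * t) ∂periodMeasure = if k = j then Real.pi else 0 := by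
  have h : ∀ t : ℝ, Real.cos (k * t) * Real.cos (j * t) =
      (1 / 2) * (Real.cos (((k - j : ℤ) : ℝ) * t) + Real.cos (((k + j : ℤ) : ℝ) * t)) := by
    intro t
    push_cast
    rw [sub_mul, add_mul, Real.cos_sub, Real.cos_add]; ring
  simp_rw [h]
  rw [integral_const_mul, integral_add (integrable_of_continuous (by fun_prop))
    (integrable_of_continuous (by fun_prop)), integral_cos_int_mul (m := k + j) (by omega)]
  split_ifs with hkj
  · subst hkj
    simp [periodMeasure_real_univ]
  · rw [integral_cos_int_mul (by omega)]; simp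

lemma integral_sin_mul_sin {k : ℕ} (hk : k ≠ 0) (j : ℕ) :
    ∫ t, Real.sin (k * t) * Real.sin (j * t) ∂periodMeasure = if k = j then Real.pi else 0 := by
  have h : ∀ t : ℝ, Real.sin (k * t) * Real.sin (j * t) =
      (1 / 2) * (Real.cos (((k - j : ℤ) : ℝ) * t) - Real.cos (((k + j : ℤ) : ℝ) * t)) := by
    intro t
    push_cast
    rw [sub_mul, add_mul, Real.cos_sub, Real.cos_add]; ring
  simp_rw [h]
  rw [integral_const_mul, integral_sub (integrable_of_continuous (by fun_prop))
    (integrable_of_continuous (by fun_prop)), integral_cos_int_mul (m := k + j) (by omega)]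
  split_ifs with hkj
  · subst hkj
    simp [periodMeasure_real_univ]
  · rw [integral_cos_int_mul (by omega)]; simp

lemma integral_sin_mul_cos (k j : ℝ) :
    ∫ t, Real.sin (k * t) * Real.cos (j * t) ∂periodMeasure = 0 := by
  have h : ∀ t : ℝ, Real.sin (k * t) * Real.cos (j * t) =
      (1 / 2) * (Real.sin ((k - j) * t) + Real.sin ((k + j) * t)) := by
    intro t
    rw [sub_mul, add_mul, Real.sin_sub, Real.sin_add]; ring
  simp_rw [h]
  rw [integral_const_mul, integral_add (integrable_of_continuous (by fun_prop))
    (integrable_of_continuous (by fun_prop)), integral_sin_mul, integral_sin_mul]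
  simp

/-- Termwise integration of an absolutely convergent trigonometric series against a weight. -/
lemma integral_trigSeries_mul {f : ℝ → ℝ} {a₀ : ℝ} {c d : ℕ → ℝ} {w : ℝ → ℝ}
    (hc : Summable fun k => |c k|) (hd : Summable fun k => |d k|)
    (hf : ∀ x, f x = a₀ / 2 + ∑' k : ℕ, (c k * Real.cos (((k + 1 : ℕ) : ℝ) * x) +
      d k * Real.sin (((k + 1 : ℕ) : ℝ) * x)))
    (hw : Continuous w) (hb : ∀ t, |w t| ≤ 1) :
    ∫ t, f t * w t ∂periodMeasure = a₀ / 2 * ∫ t, w t ∂periodMeasure +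
      ∑' k : ℕ, (c k * ∫ t, Real.cos (((k + 1 : ℕ) : ℝ) * t) * w t ∂periodMeasure +
        d k * ∫ t, Real.sin (((k + 1 : ℕ) : ℝ) * t) * w t ∂periodMeasure) := by
  set F : ℕ → ℝ → ℝ := fun k t => (c k * Real.cos (((k + 1 : ℕ) : ℝ) * t) +
      d k * Real.sin (((k + 1 : ℕ) : ℝ) * t)) * w t with hF
  have hFc : ∀ k, Continuous (F k) := fun k => by simp only [hF]; fun_prop
  have hFb : ∀ k t, ‖F k t‖ ≤ |c k| + |d k| := by
    intro k t
    simp only [hF, Real.norm_eq_abs, abs_mul]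
    calc _ ≤ |c k * Real.cos (((k + 1 : ℕ) : ℝ) * t) + d k * Real.sin (((k + 1 : ℕ) : ℝ) * t)| * 1 :=
          mul_le_mul_of_nonneg_left (hb t) (abs_nonneg _)
      _ ≤ |c k| * |Real.cos (((k + 1 : ℕ) : ℝ) * t)| + |d k| * |Real.sin (((k + 1 : ℕ) : ℝ) * t)| := by
          rw [mul_one, ← abs_mul, ← abs_mul]; exact abs_add_le _ _
      _ ≤ |c k| * 1 + |d k| * 1 := by
          gcongr
          · exact Real.abs_cos_le_one _
          · exact Real.abs_sin_le_one _
      _ = _ := by ring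
  have hs : Summable fun k => |c k| + |d k| := hc.add hd
  have hint : ∀ k, Integrable (F k) periodMeasure := fun k => integrable_of_continuous (hFc k)
  have hsum : Summable fun k => ∫ t, ‖F k t‖ ∂periodMeasure := by
    refine Summable.of_nonneg_of_le (fun k => integral_nonneg fun t => norm_nonneg _) (fun k => ?_)
      (hs.mul_left (2 * Real.pi))
    calc ∫ t, ‖F k t‖ ∂periodMeasure ≤ ∫ t, (|c k| + |d k|) ∂periodMeasure :=
          integral_mono (hint k).norm (integrable_const _) (hFb k)
      _ = _ := by simp [periodMeasure_real_univ]
  have key := hasSum_integral_of_summable_integral_norm hint hsum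
  have hFcont : Continuous fun t => ∑' k, F k t := continuous_tsum hFc hs hFb
  have e1 : ∀ t, f t * w t = a₀ / 2 * w t + ∑' k, F k t := by
    intro t
    rw [hf t, add_mul, ← tsum_mul_right]
  simp_rw [e1]
  rw [integral_add (integrable_of_continuous (by fun_prop)) (integrable_of_continuous hFcont),
    integral_const_mul, ← key.tsum_eq]
  congr 2
  ext k
  simp only [hF, add_mul, mul_assoc]
  rw [integral_add (integrable_of_continuous (by fun_prop)) (integrable_of_continuous (by fun_prop)),
    integral_const_mul, integral_const_mul]

lemma cosCoeff_eq (f : ℝ → ℝ) (k : ℕ) :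
    cosCoeff f k = (1 / Real.pi) * ∫ t, f t * Real.cos (k * t) ∂periodMeasure := by
  rw [cosCoeff, intervalIntegral_eq_periodMeasure]

lemma sinCoeff_eq (f : ℝ → ℝ) (k : ℕ) :
    sinCoeff f k = (1 / Real.pi) * ∫ t, f t * Real.sin (k * t) ∂periodMeasure := by
  rw [sinCoeff, intervalIntegral_eq_periodMeasure]

lemma cosCoeff_zero_trigSeries {f : ℝ → ℝ} {a₀ : ℝ} {c d : ℕ → ℝ}
    (hc : Summable fun k => |c k|) (hd : Summable fun k => |d k|)
    (hf : ∀ x, f x = a₀ / 2 + ∑' k : ℕ, (c k * Real.cos (((k + 1 : ℕ) : ℝ) * x) +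
      d k * Real.sin (((k + 1 : ℕ) : ℝ) * x))) :
    cosCoeff f 0 = a₀ := by
  rw [cosCoeff_eq, integral_trigSeries_mul hc hd hf (w := fun t => Real.cos ((0 : ℕ) * t))
    (by fun_prop) (fun t => Real.abs_cos_le_one _)]
  have h1 : ∀ k : ℕ, ∫ t, Real.cos (((k + 1 : ℕ) : ℝ) * t) * Real.cos ((0 : ℕ) * t) ∂periodMeasure
      = 0 := fun k => by rw [integral_cos_mul_cos (by omega)]; simp
  simp_rw [h1, integral_sin_mul_cos]
  simp [periodMeasure_real_univ]
  field_simp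

lemma cosCoeff_succ_trigSeries {f : ℝ → ℝ} {a₀ : ℝ} {c d : ℕ → ℝ}
    (hc : Summable fun k => |c k|) (hd : Summable fun k => |d k|)
    (hf : ∀ x, f x = a₀ / 2 + ∑' k : ℕ, (c k * Real.cos (((k + 1 : ℕ) : ℝ) * x) +
      d k * Real.sin (((k + 1 : ℕ) : ℝ) * x))) (j : ℕ) :
    cosCoeff f (j + 1) = c j := by
  rw [cosCoeff_eq, integral_trigSeries_mul hc hd hf (w := fun t => Real.cos ((j + 1 : ℕ) * t))
    (by fun_prop) (fun t => Real.abs_cos_le_one _)]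
  simp_rw [integral_sin_mul_cos, integral_cos_mul_cos (Nat.succ_ne_zero _)]
  rw [tsum_eq_single j (by intro b hb; simp [hb])]
  have := integral_cos_int_mul (m := ((j + 1 : ℕ) : ℤ)) (by omega)
  rw [Int.cast_natCast] at this
  rw [this]
  simp
  field_simp

lemma sinCoeff_succ_trigSeries {f : ℝ → ℝ} {a₀ : ℝ} {c d : ℕ → ℝ}
    (hc : Summable fun k => |c k|) (hd : Summable fun k => |d k|)
    (hf : ∀ x, f x = a₀ / 2 + ∑' k : ℕ, (c k * Real.cos (((k + 1 : ℕ) : ℝ) * x) +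
      d k * Real.sin (((k + 1 : ℕ) : ℝ) * x))) (j : ℕ) :
    sinCoeff f (j + 1) = d j := by
  rw [sinCoeff_eq, integral_trigSeries_mul hc hd hf (w := fun t => Real.sin ((j + 1 : ℕ) * t))
    (by fun_prop) (fun t => Real.abs_sin_le_one _)]
  have h1 : ∀ k : ℕ, ∫ t, Real.cos (((k + 1 : ℕ) : ℝ) * t) * Real.sin ((j + 1 : ℕ) * t)
      ∂periodMeasure = 0 := fun k => by
    rw [← integral_sin_mul_cos ((j + 1 : ℕ) : ℝ) ((k + 1 : ℕ) : ℝ)]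
    congr 1; ext t; ring
  simp_rw [h1, integral_sin_mul, integral_sin_mul_sin (Nat.succ_ne_zero _)]
  rw [tsum_eq_single j (by intro b hb; simp [hb])]
  simp
  field_simp

/-- The deviation of a trigonometric series from its partial sum is the remainder. -/
lemma sub_fourierSum_trigSeries {f : ℝ → ℝ} {a₀ : ℝ} {c d : ℕ → ℝ}
    (hc : Summable fun k => |c k|) (hd : Summable fun k => |d k|)
    (hf : ∀ x, f x = a₀ / 2 + ∑' k : ℕ, (c k * Real.cos (((k + 1 : ℕ) : ℝ) * x) +
      d k * Real.sin (((k + 1 : ℕ) : ℝ) * x))) (m : ℕ) (x : ℝ) :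
    f x - fourierSum m f x = ∑' k : ℕ, (c (k + m) * Real.cos (((k + m + 1 : ℕ) : ℝ) * x) +
      d (k + m) * Real.sin (((k + m + 1 : ℕ) : ℝ) * x)) := by
  have hs : Summable fun k : ℕ => (c k * Real.cos (((k + 1 : ℕ) : ℝ) * x) +
      d k * Real.sin (((k + 1 : ℕ) : ℝ) * x)) := by
    refine Summable.add ?_ ?_
    · refine Summable.of_norm_bounded hc fun k => ?_
      rw [norm_mul]
      exact mul_le_of_le_one_right (abs_nonneg _) (Real.abs_cos_le_one _)
    · refine Summable.of_norm_bounded hd fun k => ?_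
      rw [norm_mul]
      exact mul_le_of_le_one_right (abs_nonneg _) (Real.abs_sin_le_one _)
  rw [fourierSum, cosCoeff_zero_trigSeries hc hd hf, hf x, ← hs.sum_add_tsum_nat_add m]
  have : ∑ k ∈ Finset.Icc 1 m, (cosCoeff f k * Real.cos (k * x) + sinCoeff f k * Real.sin (k * x))
      = ∑ k ∈ Finset.range m, (c k * Real.cos (((k + 1 : ℕ) : ℝ) * x) +
      d k * Real.sin (((k + 1 : ℕ) : ℝ) * x)) := by
    rw [Finset.range_eq_Ico, show Finset.Icc 1 m = Finset.Ico (0 + 1) (m + 1) from rfl,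
      ← Finset.sum_Ico_add']
    refine Finset.sum_congr rfl fun k _ => ?_
    rw [cosCoeff_succ_trigSeries hc hd hf, sinCoeff_succ_trigSeries hc hd hf]
  rw [this]
  ring

/-! ### The tail kernel and the deviation from the Fourier sum -/

/-- The tail `∑_{k ≥ n} k^{-r} cos (k t - β π / 2)` of the Weyl–Nagy kernel. -/
def tailKernel (n : ℕ) (r β t : ℝ) : ℝ :=
  ∑' k : ℕ, ((k + n : ℕ) : ℝ) ^ (-r) * Real.cos (((k + n : ℕ) : ℝ) * t - β * Real.pi / 2)

lemma kernel_eq_tailKernel (r β : ℝ) : kernel r β = tailKernel 1 r β := rfl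

lemma summable_tail_weights {r : ℝ} (hr : 1 < r) (n : ℕ) :
    Summable fun k : ℕ => ((k + n : ℕ) : ℝ) ^ (-r) :=
  (summable_nat_add_iff (f := fun k : ℕ => (k : ℝ) ^ (-r)) n).2
    (Real.summable_nat_rpow.2 (by linarith))

lemma norm_tail_term_le (n k : ℕ) (r s : ℝ) :
    ‖((k + n : ℕ) : ℝ) ^ (-r) * Real.cos s‖ ≤ ((k + n : ℕ) : ℝ) ^ (-r) := by
  have h : 0 ≤ ((k + n : ℕ) : ℝ) ^ (-r) := by positivity
  rw [norm_mul, Real.norm_of_nonneg h]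
  exact mul_le_of_le_one_right h (Real.abs_cos_le_one _)

lemma continuous_tailKernel (n : ℕ) {r : ℝ} (hr : 1 < r) (β : ℝ) :
    Continuous (tailKernel n r β) :=
  continuous_tsum (fun k => by fun_prop) (summable_tail_weights hr n)
    (fun k t => norm_tail_term_le n k r _)

lemma periodic_tailKernel (n : ℕ) (r β : ℝ) :
    Function.Periodic (tailKernel n r β) (2 * Real.pi) := by
  intro t
  unfold tailKernel
  congr 1; ext k
  rw [← Real.cos_add_nat_mul_two_pi (((k + n : ℕ) : ℝ) * t - β * Real.pi / 2) (k + n)]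
  ring_nf

lemma exists_bound_of_continuous_periodic {h : ℝ → ℝ} (hc : Continuous h)
    (hp : Function.Periodic h (2 * Real.pi)) : ∃ C, ∀ t, |h t| ≤ C := by
  obtain ⟨C, hC⟩ := (isCompact_Icc (a := (0 : ℝ)) (b := 2 * Real.pi)).exists_bound_of_continuousOn
    hc.continuousOn
  refine ⟨C, fun t => ?_⟩
  obtain ⟨y, hy, hty⟩ := hp.exists_mem_Ico₀ Real.two_pi_pos t
  rw [hty]
  exact hC y ⟨hy.1, hy.2.le⟩

lemma integrable_reflect {φ : ℝ → ℝ} (hp : Function.Periodic φ (2 * Real.pi))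
    (hφ : Integrable φ periodMeasure) (x : ℝ) :
    Integrable (fun t => φ (x - t)) periodMeasure := by
  rw [← memLp_one_iff_integrable] at hφ ⊢
  refine ⟨aestronglyMeasurable_reflect hp hφ.1 x, ?_⟩
  have := periodNorm_reflect hp hφ.1 1 x
  rw [periodNorm_eq, periodNorm_eq] at this
  rw [this]; exact hφ.2

lemma integrable_mul_of_bound {φ w : ℝ → ℝ} (hφ : Integrable φ periodMeasure)
    (hw : Continuous w) {C : ℝ} (hC : ∀ t, |w t| ≤ C) :
    Integrable (fun t => φ t * w t) periodMeasure :=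
  hφ.mul_bdd (c := C) hw.aestronglyMeasurable (Filter.Eventually.of_forall hC)

/-- The substitution `t ↦ x - t` moves `x` into the cosine, where the addition formula separates it
from `t`. Convolution with a harmonic of order `m` is thus again a harmonic of order `m`. -/
lemma integral_reflect_mul_cos {φ : ℝ → ℝ} (hp : Function.Periodic φ (2 * Real.pi))
    (hφ : Integrable φ periodMeasure) (m : ℕ) (γ x : ℝ) :
    ∫ t, φ (x - t) * Real.cos (m * t - γ) ∂periodMeasure =
      (∫ t, φ t * Real.cos (m * t + γ) ∂periodMeasure) * Real.cos (m * x) +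
      (∫ t, φ t * Real.sin (m * t + γ) ∂periodMeasure) * Real.sin (m * x) := by
  have hper : Function.Periodic (fun t => φ t * Real.cos (m * (x - t) - γ)) (2 * Real.pi) := by
    intro t
    simp only
    rw [hp t, ← Real.cos_sub_nat_mul_two_pi (m * (x - t) - γ) m]
    ring_nf
  have h := integral_reflect hper x
  simp only [sub_sub_cancel] at h
  rw [h, ← integral_mul_const, ← integral_mul_const, ← integral_add]
  · congr 1; ext t
    rw [show (m : ℝ) * (x - t) - γ = m * x - (m * t + γ) by ring, Real.cos_sub]; ring
  · exact (integrable_mul_of_bound hφ (by fun_prop) fun t => Real.abs_cos_le_one _).mul_const _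
  · exact (integrable_mul_of_bound hφ (by fun_prop) fun t => Real.abs_sin_le_one _).mul_const _

lemma integral_reflect_mul_tailKernel {φ : ℝ → ℝ} (hp : Function.Periodic φ (2 * Real.pi))
    (hφ : Integrable φ periodMeasure) (n : ℕ) {r : ℝ} (hr : 1 < r) (β x : ℝ) :
    ∫ t, φ (x - t) * tailKernel n r β t ∂periodMeasure =
      ∑' k : ℕ, ((k + n : ℕ) : ℝ) ^ (-r) *
        ((∫ t, φ t * Real.cos ((k + n : ℕ) * t + β * Real.pi / 2) ∂periodMeasure) *
            Real.cos ((k + n : ℕ) * x) +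
          (∫ t, φ t * Real.sin ((k + n : ℕ) * t + β * Real.pi / 2) ∂periodMeasure) *
            Real.sin ((k + n : ℕ) * x)) := by
  have hφx := integrable_reflect hp hφ x
  set F : ℕ → ℝ → ℝ := fun k t => φ (x - t) * (((k + n : ℕ) : ℝ) ^ (-r) *
    Real.cos (((k + n : ℕ) : ℝ) * t - β * Real.pi / 2)) with hF
  have hint : ∀ k, Integrable (F k) periodMeasure := fun k =>
    integrable_mul_of_bound hφx (by fun_prop) (fun t => norm_tail_term_le n k r _)
  have hsum : Summable fun k => ∫ t, ‖F k t‖ ∂periodMeasure := by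
    refine Summable.of_nonneg_of_le (fun k => integral_nonneg fun t => norm_nonneg _) (fun k => ?_)
      ((summable_tail_weights hr n).mul_left (∫ t, ‖φ (x - t)‖ ∂periodMeasure))
    rw [← integral_mul_const]
    refine integral_mono (hint k).norm (hφx.norm.mul_const _) fun t => ?_
    simp only [hF, norm_mul]
    rw [← norm_mul (((k + n : ℕ) : ℝ) ^ (-r))]
    exact mul_le_mul_of_nonneg_left (norm_tail_term_le n k r _) (norm_nonneg _)
  have key := hasSum_integral_of_summable_integral_norm hint hsum
  have e1 : ∀ t, φ (x - t) * tailKernel n r β t = ∑' k, F k t := by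
    intro t; rw [tailKernel, ← tsum_mul_left]
  simp_rw [e1]
  rw [← key.tsum_eq]
  congr 1; ext k
  rw [← integral_reflect_mul_cos hp hφ, ← integral_const_mul]
  congr 1; ext t
  simp only [hF]; ring

lemma abs_integral_mul_le {φ w : ℝ → ℝ} (hφ : Integrable φ periodMeasure)
    (hw : Continuous w) (hb : ∀ t, |w t| ≤ 1) :
    |∫ t, φ t * w t ∂periodMeasure| ≤ ∫ t, ‖φ t‖ ∂periodMeasure := by
  refine (norm_integral_le_integral_norm _).trans
    (integral_mono (integrable_mul_of_bound hφ hw hb).norm hφ.norm fun t => ?_)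
  simp only [norm_mul]
  exact mul_le_of_le_one_right (norm_nonneg _) (hb t)

/-- The deviation of a convolution from its Fourier sum is the convolution with the tail kernel. -/
lemma sub_fourierSum_convolution {φ f : ℝ → ℝ} (hp : Function.Periodic φ (2 * Real.pi))
    (hφ : Integrable φ periodMeasure) {n : ℕ} (hn : 1 ≤ n) {r : ℝ} (hr : 1 < r) (β a₀ : ℝ)
    (hf : ∀ x : ℝ, f x = a₀ / 2 + (1 / Real.pi) *
      ∫ t in (-Real.pi)..Real.pi, φ (x - t) * kernel r β t) (x : ℝ) :
    f x - fourierSum (n - 1) f x =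
      (1 / Real.pi) * ∫ t, φ (x - t) * tailKernel n r β t ∂periodMeasure := by
  set A : ℕ → ℝ := fun m => ∫ t, φ t * Real.cos (m * t + β * Real.pi / 2) ∂periodMeasure with hA
  set B : ℕ → ℝ := fun m => ∫ t, φ t * Real.sin (m * t + β * Real.pi / 2) ∂periodMeasure with hB
  set c : ℕ → ℝ := fun k => (1 / Real.pi) * (((k + 1 : ℕ) : ℝ) ^ (-r) * A (k + 1)) with hc
  set d : ℕ → ℝ := fun k => (1 / Real.pi) * (((k + 1 : ℕ) : ℝ) ^ (-r) * B (k + 1)) with hd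
  have hAb : ∀ m, |A m| ≤ ∫ t, ‖φ t‖ ∂periodMeasure := fun m =>
    abs_integral_mul_le hφ (by fun_prop) fun t => Real.abs_cos_le_one _
  have hBb : ∀ m, |B m| ≤ ∫ t, ‖φ t‖ ∂periodMeasure := fun m =>
    abs_integral_mul_le hφ (by fun_prop) fun t => Real.abs_sin_le_one _
  have hsum : ∀ D : ℕ → ℝ, (∀ m, |D m| ≤ ∫ t, ‖φ t‖ ∂periodMeasure) →
      Summable fun k : ℕ => |(1 / Real.pi) * (((k + 1 : ℕ) : ℝ) ^ (-r) * D (k + 1))| := by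
    intro D hD
    refine Summable.of_nonneg_of_le (fun k => abs_nonneg _) (fun k => ?_)
      (((summable_tail_weights hr 1).mul_right (∫ t, ‖φ t‖ ∂periodMeasure)).mul_left (1 / Real.pi))
    rw [abs_mul, abs_mul, abs_of_pos (by positivity : 0 < 1 / Real.pi),
      abs_of_nonneg (by positivity : 0 ≤ ((k + 1 : ℕ) : ℝ) ^ (-r))]
    gcongr
    exact hD _
  have hf' : ∀ x, f x = a₀ / 2 + ∑' k : ℕ, (c k * Real.cos (((k + 1 : ℕ) : ℝ) * x) +
      d k * Real.sin (((k + 1 : ℕ) : ℝ) * x)) := by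
    intro x
    rw [hf x, intervalIntegral_eq_periodMeasure, kernel_eq_tailKernel,
      integral_reflect_mul_tailKernel hp hφ 1 hr, ← tsum_mul_left]
    congr 2; ext k
    simp only [hc, hd, hA, hB]; ring
  rw [sub_fourierSum_trigSeries (hsum A hAb) (hsum B hBb) hf',
    integral_reflect_mul_tailKernel hp hφ n hr, ← tsum_mul_left]
  congr 1; ext k
  -- Truncated subtraction: this needs `1 ≤ n`.
  have : k + (n - 1) + 1 = k + n := by omega
  simp only [this, hA, hB]
  ring

/-- Since `φ` is merely integrable, `x` is first moved into the kernel, which is continuous and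
bounded; dominated convergence then applies. -/
lemma continuous_convolution {φ f : ℝ → ℝ} (hp : Function.Periodic φ (2 * Real.pi))
    (hφ : Integrable φ periodMeasure) {r : ℝ} (hr : 1 < r) (β a₀ : ℝ)
    (hf : ∀ x : ℝ, f x = a₀ / 2 + (1 / Real.pi) *
      ∫ t in (-Real.pi)..Real.pi, φ (x - t) * kernel r β t) : Continuous f := by
  have : f = fun x => a₀ / 2 + (1 / Real.pi) *
      ∫ t, φ (x - t) * tailKernel 1 r β t ∂periodMeasure := by
    ext x; rw [hf, intervalIntegral_eq_periodMeasure]; rfl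
  rw [this]
  have h2 : ∀ x, ∫ t, φ (x - t) * tailKernel 1 r β t ∂periodMeasure =
      ∫ t, φ t * tailKernel 1 r β (x - t) ∂periodMeasure := by
    intro x
    have hper : Function.Periodic (fun t => φ t * tailKernel 1 r β (x - t)) (2 * Real.pi) := by
      intro t
      have := periodic_reflect (periodic_tailKernel 1 r β) x t
      simp only at this ⊢
      rw [hp t, this]
    have h := integral_reflect hper x
    simpa only [sub_sub_cancel] using h
  simp_rw [h2]
  have hk := continuous_tailKernel 1 hr β
  obtain ⟨C, hC⟩ := exists_bound_of_continuous_periodic hk (periodic_tailKernel 1 r β)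
  refine continuous_const.add (continuous_const.mul (continuous_of_dominated
    (bound := fun t => ‖φ t‖ * C) (fun x => ?_) (fun x => ?_) (hφ.norm.mul_const _) ?_))
  · exact (integrable_mul_of_bound hφ (by fun_prop) (fun t => hC _)).aestronglyMeasurable
  · refine Filter.Eventually.of_forall fun t => ?_
    rw [norm_mul]
    exact mul_le_mul_of_nonneg_left (hC _) (norm_nonneg _)
  · exact Filter.Eventually.of_forall fun t => by fun_prop

/-! ### Extremal functions for Hölder's inequality -/

lemma realNorm_rpow_toReal {h : ℝ → ℝ} {s : ℝ≥0∞} (hh : MemLp h s periodMeasure) (hs : 1 ≤ s)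
    (hst : s ≠ ⊤) : realNorm s h ^ s.toReal = ∫ t, |h t| ^ s.toReal ∂periodMeasure := by
  have h0 : s ≠ 0 := (zero_lt_one.trans_le hs).ne'
  have hpos : 0 < s.toReal := ENNReal.toReal_pos h0 hst
  have hI : 0 ≤ ∫ t, ‖h t‖ ^ s.toReal ∂periodMeasure := integral_nonneg fun t => by positivity
  rw [realNorm, periodNorm_eq, hh.eLpNorm_eq_integral_rpow_norm h0 hst,
    ENNReal.toReal_ofReal (by positivity), ← Real.rpow_mul hI, inv_mul_cancel₀ hpos.ne',
    Real.rpow_one]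
  rfl

/-- A choice of sign with values `±1`. -/
def sgn (x : ℝ) : ℝ := if 0 ≤ x then 1 else -1

lemma measurable_sgn : Measurable sgn :=
  Measurable.ite measurableSet_Ici measurable_const measurable_const

lemma sgn_mul_self (x : ℝ) : sgn x * x = |x| := by
  unfold sgn; split_ifs with h
  · rw [abs_of_nonneg h, one_mul]
  · rw [abs_of_neg (not_le.1 h)]; ring

lemma abs_sgn (x : ℝ) : |sgn x| = 1 := by
  unfold sgn; split_ifs <;> simp

/-- No extremizer need exist in `L_1`. Instead `φ` is the normalized indicator of the set where
`|h|` is within `ε` of its supremum, multiplied by the sign of `h`. -/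
lemma exists_dual_top {h : ℝ → ℝ} (hc : Continuous h) (hp : Function.Periodic h (2 * Real.pi))
    {ε : ℝ} (hε : 0 < ε) :
    ∃ φ : ℝ → ℝ, Measurable φ ∧ (∃ C, ∀ t, |φ t| ≤ C) ∧ Function.Periodic φ (2 * Real.pi) ∧
      periodNorm 1 φ ≤ 1 ∧ realNorm ⊤ h - ε ≤ ∫ t, φ t * h t ∂periodMeasure := by
  set L := realNorm ⊤ h with hL
  by_cases hLε : L ≤ ε
  · refine ⟨0, measurable_const, ⟨0, by simp⟩, fun t => rfl, ?_, ?_⟩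
    · rw [periodNorm_eq]; simp
    · simp; exact hLε
  push Not at hLε
  set U : Set ℝ := {t | L - ε < |h t|} with hU
  have hUm : MeasurableSet U := measurableSet_lt measurable_const hc.measurable.abs
  have hpos : periodMeasure U ≠ 0 := by
    intro h0
    have hae : ∀ᵐ t ∂periodMeasure, ‖h t‖ ≤ L - ε := by
      rw [ae_iff]
      convert h0 using 2
      ext t; simp [hU]
    have h1 : periodNorm ⊤ h ≤ ENNReal.ofReal (L - ε) := by
      rw [periodNorm_eq, eLpNorm_exponent_top]
      exact eLpNormEssSup_le_of_ae_bound hae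
    have h2 := ENNReal.toReal_mono ENNReal.ofReal_ne_top h1
    rw [ENNReal.toReal_ofReal (by linarith)] at h2
    change L ≤ L - ε at h2
    linarith
  set m := periodMeasure.real U with hm
  have hmpos : 0 < m := ENNReal.toReal_pos hpos (measure_ne_top _ _)
  have habs : ∀ t, |U.indicator (fun t => sgn (h t) * m⁻¹) t| = U.indicator (fun _ => m⁻¹) t := by
    intro t
    by_cases ht : t ∈ U
    · simp [ht, abs_mul, abs_sgn, abs_of_pos hmpos]
    · simp [ht]
  refine ⟨U.indicator fun t => sgn (h t) * m⁻¹,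
    ((measurable_sgn.comp hc.measurable).mul_const _).indicator hUm, ⟨m⁻¹, fun t => ?_⟩,
    fun t => ?_, ?_, ?_⟩
  · rw [habs]
    exact Set.indicator_le_self' (fun _ _ => by positivity) t
  · simp only [Set.indicator, hU, Set.mem_ofPred_eq, hp t]
  · rw [periodNorm_eq, eLpNorm_one_eq_lintegral_enorm]
    have : ∀ t, ‖U.indicator (fun t => sgn (h t) * m⁻¹) t‖ₑ =
        U.indicator (fun _ => ENNReal.ofReal m⁻¹) t := by
      intro t
      rw [← ofReal_norm, Real.norm_eq_abs, habs]
      by_cases ht : t ∈ U <;> simp [ht]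
    simp_rw [this]
    rw [lintegral_indicator hUm, setLIntegral_const, ← ofReal_measureReal,
      ← ENNReal.ofReal_mul (by positivity), ← hm, inv_mul_cancel₀ hmpos.ne']
    simp
  · have e : ∀ t, U.indicator (fun t => sgn (h t) * m⁻¹) t * h t =
        U.indicator (fun t => m⁻¹ * |h t|) t := by
      intro t
      by_cases ht : t ∈ U
      · simp only [ht, Set.indicator_of_mem]
        rw [← sgn_mul_self]; ring
      · simp [ht]
    simp_rw [e]
    rw [integral_indicator hUm]
    calc L - ε = ∫ t in U, m⁻¹ * (L - ε) ∂periodMeasure := by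
          rw [setIntegral_const, smul_eq_mul, ← hm]; field_simp
      _ ≤ _ := by
          refine setIntegral_mono_on (integrable_const _)
            (integrable_of_continuous (by fun_prop)).integrableOn hUm fun t ht => ?_
          exact mul_le_mul_of_nonneg_left (le_of_lt ht) (by positivity)

/-- The extremizer is `sgn h · (|h| / L)^(σ - 1)` with `L = ‖h‖_s` and `σ = s`: its `p`-th power has
integral one because `(σ - 1) p = σ`. For `p = ∞`, `σ = 1` and it has modulus one everywhere,
including at zeros of `h`. -/
lemma exists_dual_of_ne_top {h : ℝ → ℝ} (hc : Continuous h)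
    (hp : Function.Periodic h (2 * Real.pi)) {p s : ℝ≥0∞} (hps : p.HolderConjugate s)
    (hst : s ≠ ⊤) :
    ∃ φ : ℝ → ℝ, Measurable φ ∧ (∃ C, ∀ t, |φ t| ≤ C) ∧ Function.Periodic φ (2 * Real.pi) ∧
      periodNorm p φ ≤ 1 ∧ realNorm s h ≤ ∫ t, φ t * h t ∂periodMeasure := by
  have hs1 : 1 ≤ s := hps.symm.one_le
  have hp1 : 1 ≤ p := hps.one_le
  set L := realNorm s h with hL
  set σ := s.toReal with hσ
  have hσ1 : 1 ≤ σ := by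
    rw [hσ, ← ENNReal.toReal_one]; exact ENNReal.toReal_mono hst hs1
  have hLσ : L ^ σ = ∫ t, |h t| ^ σ ∂periodMeasure :=
    realNorm_rpow_toReal (memLp_of_continuous hc s) hs1 hst
  rcases (realNorm_nonneg s h).eq_or_lt with h0 | hpos
  · refine ⟨0, measurable_const, ⟨0, by simp⟩, fun t => rfl, ?_, ?_⟩
    · rw [periodNorm_eq]; simp
    · rw [hL, ← h0]; simp
  change 0 < L at hpos
  obtain ⟨C, hC⟩ := exists_bound_of_continuous_periodic hc hp
  set φ : ℝ → ℝ := fun t => sgn (h t) * (|h t| / L) ^ (σ - 1) with hφ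
  have hφabs : ∀ t, |φ t| = (|h t| / L) ^ (σ - 1) := by
    intro t
    rw [hφ, abs_mul, abs_sgn, one_mul, abs_of_nonneg (by positivity)]
  have hφm : Measurable φ := (measurable_sgn.comp hc.measurable).mul
    ((hc.measurable.abs.div_const _).pow_const _)
  have hφb : ∀ t, |φ t| ≤ (C / L) ^ (σ - 1) := by
    intro t; rw [hφabs]
    have := hC t
    gcongr
  refine ⟨φ, hφm, ⟨_, hφb⟩, fun t => ?_, ?_, ?_⟩
  · simp only [hφ, hp t]
  · rcases eq_or_ne p ⊤ with rfl | hpt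
    · have hs : s = 1 := by
        have := ENNReal.holderConjugate_iff.1 hps
        simpa using this
      have hσ' : σ = 1 := by rw [hσ, hs]; simp
      rw [periodNorm_eq, eLpNorm_exponent_top]
      refine (eLpNormEssSup_le_of_ae_bound (C := 1) (Filter.Eventually.of_forall fun t => ?_)).trans
        (by simp)
      rw [Real.norm_eq_abs, hφabs, hσ']; simp
    · have hmem : MemLp φ p periodMeasure :=
        MemLp.of_bound hφm.aestronglyMeasurable _ (Filter.Eventually.of_forall hφb)
      have hp0 : p ≠ 0 := (zero_lt_one.trans_le hp1).ne'
      have hconj : (σ - 1) * p.toReal = σ := by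
        have h1 := ENNReal.holderConjugate_iff.1 hps
        have h2 := congrArg ENNReal.toReal h1
        rw [ENNReal.toReal_add (by simpa using hp0)
          (by simpa using (zero_lt_one.trans_le hs1).ne'), ENNReal.toReal_inv, ENNReal.toReal_inv,
          ← hσ, ENNReal.toReal_one] at h2
        have hpp : 0 < p.toReal := ENNReal.toReal_pos hp0 hpt
        field_simp at h2
        linarith
      rw [periodNorm_eq, hmem.eLpNorm_eq_integral_rpow_norm hp0 hpt]
      have : ∫ t, ‖φ t‖ ^ p.toReal ∂periodMeasure = 1 := by
        have e : ∀ t, ‖φ t‖ ^ p.toReal = |h t| ^ σ / L ^ σ := by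
          intro t
          rw [Real.norm_eq_abs, hφabs, ← Real.rpow_mul (by positivity), hconj,
            Real.div_rpow (abs_nonneg _) hpos.le]
        simp_rw [e]
        rw [integral_div, ← hLσ, div_self (by positivity)]
      rw [this]; simp
  · have e : ∀ t, φ t * h t = L * (|h t| ^ σ / L ^ σ) := by
      intro t
      have e1 : φ t * h t = (|h t| / L) ^ (σ - 1) * |h t| := by
        simp only [hφ]
        conv_rhs => enter [2]; rw [← sgn_mul_self]
        ring
      rw [e1, ← Real.div_rpow (abs_nonneg _) hpos.le]
      conv_rhs => rw [show σ = (σ - 1) + 1 by ring]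
      rw [Real.rpow_add_of_nonneg (by positivity) (by linarith) (by norm_num), Real.rpow_one]
      field_simp
    simp_rw [e]
    rw [integral_const_mul, integral_div, ← hLσ, div_self (by positivity), mul_one]

lemma exists_dual {h : ℝ → ℝ} (hc : Continuous h)
    (hp : Function.Periodic h (2 * Real.pi)) {p s : ℝ≥0∞} (hps : p.HolderConjugate s)
    {ε : ℝ} (hε : 0 < ε) :
    ∃ φ : ℝ → ℝ, Measurable φ ∧ (∃ C, ∀ t, |φ t| ≤ C) ∧ Function.Periodic φ (2 * Real.pi) ∧
      periodNorm p φ ≤ 1 ∧ realNorm s h - ε ≤ ∫ t, φ t * h t ∂periodMeasure := by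
  rcases eq_or_ne s ⊤ with rfl | hst
  · have hp1 : p = 1 := by
      have := ENNReal.holderConjugate_iff.1 hps
      simpa using this
    subst hp1
    exact exists_dual_top hc hp hε
  · obtain ⟨φ, h1, h2, h3, h4, h5⟩ := exists_dual_of_ne_top hc hp hps hst
    exact ⟨φ, h1, h2, h3, h4, by linarith⟩

/-! ### Two-sided bounds for the error by norms of the tail -/

lemma integrable_of_mem_unitBall {p : ℝ≥0∞} (hp : 1 ≤ p) {φ : ℝ → ℝ} (hφ : φ ∈ unitBall p) :
    Integrable φ periodMeasure :=
  MemLp.integrable (μ := periodMeasure) hp hφ.2.1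

lemma fourierError_le {p s : ℝ≥0∞} (hps : p.HolderConjugate s) {r β : ℝ} (hr : 1 < r) {n : ℕ}
    (hn : 1 ≤ n) :
    fourierError n (weylNagyClass r β p) ≤
      ENNReal.ofReal ((1 / Real.pi) * realNorm s (tailKernel n r β)) := by
  have hk := continuous_tailKernel n hr β
  refine iSup₂_le fun f hf => iSup_le fun x => ?_
  obtain ⟨-, a₀, φ, hφ, hfφ⟩ := hf
  have hφi := integrable_of_mem_unitBall hps.one_le hφ
  change ‖f x - fourierSum (n - 1) f x‖ₑ ≤ _
  rw [sub_fourierSum_convolution hφ.1 hφi hn hr β a₀ hfφ x, enorm_mul,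
    ENNReal.ofReal_mul (by positivity), realNorm, ENNReal.ofReal_toReal (periodNorm_ne_top hk s),
    Real.enorm_of_nonneg (by positivity)]
  gcongr
  calc _ ≤ ∫⁻ t, ‖φ (x - t) * tailKernel n r β t‖ₑ ∂periodMeasure := enorm_integral_le_lintegral_enorm _
    _ = eLpNorm ((fun t => φ (x - t)) • tailKernel n r β) 1 periodMeasure := by
        rw [eLpNorm_one_eq_lintegral_enorm]; rfl
    _ ≤ eLpNorm (fun t => φ (x - t)) p periodMeasure * eLpNorm (tailKernel n r β) s periodMeasure := by
        have : p.HolderTriple s 1 := hps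
        exact eLpNorm_smul_le_mul_eLpNorm hk.aestronglyMeasurable
          (aestronglyMeasurable_reflect hφ.1 hφi.1 x)
    _ ≤ 1 * eLpNorm (tailKernel n r β) s periodMeasure := by
        refine mul_le_mul' ?_ le_rfl
        have := periodNorm_reflect hφ.1 hφi.1 p x
        rw [periodNorm_eq] at this
        rw [this]; exact hφ.2.2.1
    _ = _ := by rw [one_mul]; rfl

/-- A nearly extremal `φ₀` for the difference of the tail and its translate need not have mean zero.
Half the difference of `φ₀` and its translate does, and moving the translation onto the tail
recovers the pairing with that difference. -/
lemma le_fourierError {p s : ℝ≥0∞} (hps : p.HolderConjugate s) {r β : ℝ} (hr : 1 < r) {n : ℕ}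
    (hn : 1 ≤ n) (δ : ℝ) {ε : ℝ} (hε : 0 < ε) :
    ENNReal.ofReal ((1 / Real.pi) * ((1 / 2) *
      (realNorm s (fun t => tailKernel n r β t - tailKernel n r β (t + δ)) - ε))) ≤
      fourierError n (weylNagyClass r β p) := by
  have hk := continuous_tailKernel n hr β
  have hkp := periodic_tailKernel n r β
  have hhp : Function.Periodic (fun t => tailKernel n r β t - tailKernel n r β (t + δ))
      (2 * Real.pi) := fun t => by
    have := periodic_shift hkp δ t
    simp only at this ⊢
    rw [hkp t, this]
  obtain ⟨φ₀, hm, ⟨C, hC⟩, hφp, hφ1, hφ2⟩ := exists_dual (by fun_prop) hhp hps hε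
  have hb : ∀ p, MemLp φ₀ p periodMeasure := fun p =>
    MemLp.of_bound hm.aestronglyMeasurable C (Filter.Eventually.of_forall hC)
  set φ₁ : ℝ → ℝ := fun t => (1 / 2) * (φ₀ t - φ₀ (t - δ)) with hφ₁
  have hm1 : Measurable φ₁ := (hm.sub (hm.comp (measurable_id.sub_const δ))).const_mul _
  have hC1 : ∀ t, |φ₁ t| ≤ C := by
    intro t
    have h1 := abs_le.1 (hC t)
    have h2 := abs_le.1 (hC (t - δ))
    simp only [hφ₁]; rw [abs_le]; constructor <;> linarith
  have hp1 : Function.Periodic φ₁ (2 * Real.pi) := fun t => by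
    have := periodic_shift hφp (-δ) t
    simp only [← sub_eq_add_neg] at this
    simp only [hφ₁, hφp t, this]
  have hsm : AEStronglyMeasurable (fun t => φ₀ (t - δ)) periodMeasure :=
    (hm.comp (measurable_id.sub_const δ)).aestronglyMeasurable
  have hN1 : periodNorm p φ₁ ≤ 1 := by
    have e : φ₁ = (1 / 2 : ℝ) • (φ₀ - fun t => φ₀ (t - δ)) := by ext t; simp [hφ₁]
    have h3 : eLpNorm (φ₀ - fun t => φ₀ (t - δ)) p periodMeasure ≤ 1 + 1 := by
      refine (eLpNorm_sub_le (hb p).1 hsm hps.one_le).trans (add_le_add hφ1 ?_)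
      have := periodNorm_shift hφp hm.aestronglyMeasurable p (-δ)
      simp only [← sub_eq_add_neg] at this
      rw [periodNorm_eq] at this
      rw [this]; exact hφ1
    rw [periodNorm_eq, e, eLpNorm_const_smul]
    calc _ ≤ ‖(1 / 2 : ℝ)‖ₑ * (1 + 1) := mul_le_mul' le_rfl h3
      _ = 1 := by
        rw [Real.enorm_of_nonneg (by norm_num), one_add_one_eq_two,
          show (2 : ℝ≥0∞) = ENNReal.ofReal 2 by simp, ← ENNReal.ofReal_mul (by norm_num)]
        norm_num
  have hi0 : Integrable φ₀ periodMeasure := (hb 1).integrable le_rfl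
  have hi1 : Integrable (fun t => φ₀ (t - δ)) periodMeasure :=
    (MemLp.of_bound hsm C (Filter.Eventually.of_forall fun t => hC _) :
      MemLp _ 1 periodMeasure).integrable le_rfl
  -- The reflection turns the convolution at `x = 0` into the pairing of `φ₁` with the tail.
  set φ : ℝ → ℝ := fun t => φ₁ (0 - t) with hφ
  have hmφ : Measurable φ := hm1.comp (measurable_id.const_sub 0)
  have hφmem : φ ∈ unitBall p := by
    refine ⟨periodic_reflect hp1 0, MemLp.of_bound hmφ.aestronglyMeasurable C
      (Filter.Eventually.of_forall fun t => hC1 _), ?_, ?_⟩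
    · rw [hφ, periodNorm_reflect hp1 hm1.aestronglyMeasurable]; exact hN1
    · rw [intervalIntegral_eq_periodMeasure, hφ, integral_reflect hp1, hφ₁, integral_const_mul,
        integral_sub hi0 hi1]
      have := integral_shift hφp (-δ)
      simp only [← sub_eq_add_neg] at this
      rw [this]; simp
  have hφi := integrable_of_mem_unitBall hps.one_le hφmem
  set f : ℝ → ℝ := fun x => (0 : ℝ) / 2 + (1 / Real.pi) *
    ∫ t in (-Real.pi)..Real.pi, φ (x - t) * kernel r β t with hf
  have hfmem : f ∈ weylNagyClass r β p := by
    refine ⟨fun x => ?_, 0, φ, hφmem, fun x => rfl⟩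
    simp only [hf]
    congr 3; ext t
    rw [← hφmem.1 (x - t)]; ring_nf
  refine le_trans ?_ (le_iSup₂_of_le f hfmem (le_iSup_of_le 0 le_rfl))
  change _ ≤ ‖f 0 - fourierSum (n - 1) f 0‖ₑ
  rw [sub_fourierSum_convolution hφmem.1 hφi hn hr β 0 (fun x => rfl) 0]
  have e2 : ∫ t, φ (0 - t) * tailKernel n r β t ∂periodMeasure =
      (1 / 2) * ∫ t, φ₀ t * (tailKernel n r β t - tailKernel n r β (t + δ)) ∂periodMeasure := by
    obtain ⟨D, hD⟩ := exists_bound_of_continuous_periodic hk hkp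
    have e3 : ∀ t, φ (0 - t) * tailKernel n r β t = (1 / 2) * (φ₀ t * tailKernel n r β t -
        φ₀ (t - δ) * tailKernel n r β t) := by
      intro t; simp only [hφ, hφ₁, sub_sub_cancel]; ring
    simp_rw [e3, mul_sub (φ₀ _)]
    rw [integral_const_mul, integral_sub (integrable_mul_of_bound hi0 hk hD)
      (integrable_mul_of_bound hi1 hk hD), integral_sub (integrable_mul_of_bound hi0 hk hD)
      (integrable_mul_of_bound hi0 (by fun_prop) fun t => hD _)]
    congr 2
    have hper : Function.Periodic (fun t => φ₀ (t - δ) * tailKernel n r β t) (2 * Real.pi) := by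
      intro t
      have := periodic_shift hφp (-δ) t
      simp only [← sub_eq_add_neg] at this
      simp only [hkp t, this]
    have := integral_shift hper δ
    simp only [add_sub_cancel_right] at this
    exact this.symm
  rw [e2, ← ofReal_norm]
  refine ENNReal.ofReal_le_ofReal (le_trans ?_ (Real.le_norm_self _))
  gcongr

/-- Two-sided estimate of the error of Fourier sums on a Weyl–Nagy class by the norms of the tail
of the kernel and of its difference. -/
lemma fourierError_bounds {p s : ℝ≥0∞} (hps : p.HolderConjugate s) {r : ℝ} (β : ℝ) (hr : 1 < r)
    {n : ℕ} (hn : 1 ≤ n) (δ : ℝ) :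
    fourierError n (weylNagyClass r β p) ≠ ⊤ ∧
    (fourierError n (weylNagyClass r β p)).toReal ≤
      (1 / Real.pi) * realNorm s (tailKernel n r β) ∧
    (1 / Real.pi) * ((1 / 2) *
      realNorm s (fun t => tailKernel n r β t - tailKernel n r β (t + δ))) ≤
      (fourierError n (weylNagyClass r β p)).toReal := by
  have hU := fourierError_le (β := β) hps hr hn
  have hne := ne_top_of_le_ne_top ENNReal.ofReal_ne_top hU
  refine ⟨hne, ENNReal.toReal_le_of_le_ofReal (mul_nonneg (by positivity) (realNorm_nonneg _ _)) hU,
    le_of_forall_pos_le_add fun ε hε => ?_⟩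
  have h1 := (ENNReal.ofReal_le_iff_le_toReal hne).1
    (le_fourierError (β := β) hps hr hn δ (ε := 2 * Real.pi * ε) (by positivity))
  have : (1 / Real.pi) * ((1 / 2) * (2 * Real.pi * ε)) = ε := by field_simp
  linarith

/-! ### Comparison of power weights with geometric weights -/

/-- Telescoping of `1 / (1 + ck)`. As the term `k = 0` does not contribute, the bound carries no
additive `A`. -/
lemma sum_le_of_le_inv_sq {a : ℕ → ℝ} {A c : ℝ} (hA : 0 ≤ A) (hc : 0 < c) (h0 : a 0 ≤ 0)
    (h : ∀ k : ℕ, a k ≤ A / (1 + c * k) ^ 2 ∨ k = 0) (N : ℕ) :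
    ∑ k ∈ Finset.range N, a k ≤ A / c := by
  have key : ∀ N : ℕ, ∑ k ∈ Finset.range (N + 1), a k ≤ A / c * (1 - 1 / (1 + c * N)) := by
    intro N
    induction N with
    | zero => simpa using h0
    | succ N ih =>
      rw [Finset.sum_range_succ]
      have h1 := (h (N + 1)).resolve_right (by omega)
      have h2 : A / (1 + c * (N + 1 : ℕ)) ^ 2 ≤
          A / c * (1 / (1 + c * N) - 1 / (1 + c * (N + 1 : ℕ))) := by
        have e : A / c * (1 / (1 + c * N) - 1 / (1 + c * (N + 1 : ℕ))) =
            A / ((1 + c * N) * (1 + c * (N + 1 : ℕ))) := by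
          push_cast; field_simp; ring
        rw [e, sq]
        apply div_le_div_of_nonneg_left hA (by positivity)
        gcongr
        simp
      calc _ ≤ A / c * (1 - 1 / (1 + c * N)) +
            A / c * (1 / (1 + c * N) - 1 / (1 + c * (N + 1 : ℕ))) := by linarith
        _ = _ := by ring
  cases N with
  | zero => simp; positivity
  | succ N =>
    refine (key N).trans (mul_le_of_le_one_right (by positivity) ?_)
    have : 0 ≤ 1 / (1 + c * (N : ℝ)) := by positivity
    linarith

lemma exp_neg_mul_le_rpow {r x : ℝ} (hr : 0 ≤ r) (hx : 0 ≤ x) :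
    Real.exp (-(r * x)) ≤ (1 + x) ^ (-r) := by
  rw [Real.rpow_def_of_pos (by linarith)]
  apply Real.exp_le_exp.2
  have := Real.log_le_sub_one_of_pos (show 0 < 1 + x by linarith)
  nlinarith

/-- From `log (1 + x) ≥ x - x²` the ratio of the exponential to the power is at least `e^{-r x²} ≥ 1
- r x²`. -/
lemma rpow_sub_exp_le {r x : ℝ} (hr : 0 ≤ r) (hx : 0 ≤ x) :
    (1 + x) ^ (-r) - Real.exp (-(r * x)) ≤ (1 + x) ^ (-r) * (r * x ^ 2) := by
  have hpos : 0 < 1 + x := by linarith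
  have hlog : x - x ^ 2 ≤ Real.log (1 + x) := by
    refine le_trans ?_ (Real.one_sub_inv_le_log_of_pos hpos)
    have : 1 - (1 + x)⁻¹ = x / (1 + x) := by field_simp; ring
    rw [this, le_div_iff₀ hpos]
    nlinarith [pow_nonneg hx 3]
  have h1 : (1 + x) ^ (-r) * Real.exp (-(r * x ^ 2)) ≤ Real.exp (-(r * x)) := by
    rw [Real.rpow_def_of_pos hpos, ← Real.exp_add]
    apply Real.exp_le_exp.2
    nlinarith
  have h2 : 1 - r * x ^ 2 ≤ Real.exp (-(r * x ^ 2)) := by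
    have := Real.add_one_le_exp (-(r * x ^ 2)); linarith
  have h3 : 0 < (1 + x) ^ (-r) := Real.rpow_pos_of_pos hpos _
  nlinarith [mul_le_mul_of_nonneg_left h2 h3.le]

/-- Bernoulli's inequality with exponent `r / m ≥ 1`, raised to the power `m`. -/
lemma rpow_neg_le_inv_pow {r x : ℝ} (m : ℕ) (hm : 0 < m) (hr : m ≤ r) (hx : 0 ≤ x) :
    (1 + x) ^ (-r) ≤ 1 / (1 + r / m * x) ^ m := by
  have hm' : (0 : ℝ) < m := by exact_mod_cast hm
  have h1 : 1 + r / m * x ≤ (1 + x) ^ (r / m) :=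
    one_add_mul_self_le_rpow_one_add (by linarith) ((one_le_div hm').2 hr)
  have h2 : (1 + r / m * x) ^ m ≤ (1 + x) ^ r := by
    calc _ ≤ ((1 + x) ^ (r / m)) ^ m := by
          have : 0 ≤ 1 + r / m * x := by
            have : 0 ≤ r := hm'.le.trans hr
            positivity
          gcongr
      _ = _ := by
          rw [← Real.rpow_mul_natCast (by linarith)]; congr 1; field_simp
  rw [Real.rpow_neg (by linarith), ← one_div]
  have : 0 ≤ r := hm'.le.trans hr
  exact one_div_le_one_div_of_le (by positivity) h2

lemma sum_rpow_sub_exp_le {r : ℝ} (hr : 2 ≤ r) {n : ℕ} (hn : 1 ≤ n) (N : ℕ) :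
    ∑ k ∈ Finset.range N, ((1 + (k : ℝ) / n) ^ (-r) - Real.exp (-(r * (k / n)))) ≤
      64 * (n / r ^ 2) := by
  have hn' : (0 : ℝ) < n := by exact_mod_cast hn
  rcases le_or_gt 4 r with h4 | h4
  -- With `w = 1 + r x / 4`, the factor `r x² ≤ (16 / r) w²` uses up two of the four powers in
  -- `w⁻⁴`; an inverse square remains, and `A / c = 64 n / r²`.
  · have := sum_le_of_le_inv_sq (A := 16 / r) (c := r / (4 * n))
      (a := fun k => (1 + (k : ℝ) / n) ^ (-r) - Real.exp (-(r * (k / n)))) (by positivity)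
      (by positivity) (by simp) (fun k => Or.inl ?_) N
    · refine this.trans (le_of_eq ?_)
      field_simp; norm_num
    · set x : ℝ := (k : ℝ) / n with hx
      have hx0 : 0 ≤ x := by positivity
      have e : r / (4 * n) * k = r / (4 : ℕ) * x := by rw [hx]; push_cast; field_simp
      rw [e]
      have hB := rpow_neg_le_inv_pow 4 (by norm_num) (by exact_mod_cast h4) hx0
      set w := 1 + r / (4 : ℕ) * x with hw
      have hw1 : 1 ≤ w := by
        have : 0 ≤ r / (4 : ℕ) * x := by positivity
        linarith
      have hxw : r * x ^ 2 ≤ 16 / r * w ^ 2 := by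
        have : r * x ^ 2 = 16 / r * (w - 1) ^ 2 := by rw [hw]; push_cast; field_simp; ring
        rw [this]
        have hr0 : 0 < 16 / r := by positivity
        have : (w - 1) ^ 2 ≤ w ^ 2 := by nlinarith
        exact mul_le_mul_of_nonneg_left this hr0.le
      calc _ ≤ (1 + x) ^ (-r) * (r * x ^ 2) := rpow_sub_exp_le (by linarith) hx0
        _ ≤ 1 / w ^ 4 * (16 / r * w ^ 2) := by gcongr
        _ = _ := by field_simp
  -- For `r < 4` the power alone is summed; its bound `2n / r` is below `64 n / r²` since `r` is
  -- bounded.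
  · have := sum_le_of_le_inv_sq (A := 1) (c := r / (2 * n))
      (a := fun k => (1 + (k : ℝ) / n) ^ (-r) - Real.exp (-(r * (k / n)))) (by positivity)
      (by positivity) (by simp) (fun k => Or.inl ?_) N
    · refine this.trans ?_
      rw [one_div_div, mul_div_assoc', div_le_div_iff₀ (by positivity) (by positivity)]
      nlinarith [mul_pos hn' (show 0 < r by linarith)]
    · set x : ℝ := (k : ℝ) / n with hx
      have hx0 : 0 ≤ x := by positivity
      have e : r / (2 * n) * k = r / (2 : ℕ) * x := by rw [hx]; push_cast; field_simp
      rw [e]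
      have hB := rpow_neg_le_inv_pow 2 (by norm_num) (by exact_mod_cast hr) hx0
      have := Real.exp_pos (-(r * x))
      linarith

/-! ### The Poisson-type kernel: approximation of the tail, translation and phase -/

/-- The Poisson-type kernel `Re (e^{i(nt + τ)} / (1 - q e^{it}))`. -/
def poissonKernel (q : ℝ) (n : ℕ) (τ t : ℝ) : ℝ :=
  (Complex.exp (((n * t + τ : ℝ) : ℂ) * Complex.I) *
    (1 - q * Complex.exp (t * Complex.I))⁻¹).re

lemma norm_ofReal_mul_exp {q : ℝ} (hq : 0 ≤ q) (t : ℝ) :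
    ‖(q : ℂ) * Complex.exp (t * Complex.I)‖ = q := by
  rw [norm_mul, Complex.norm_exp_ofReal_mul_I, mul_one, Complex.norm_of_nonneg hq]

lemma hasSum_poissonKernel {q : ℝ} (hq : 0 ≤ q) (hq1 : q < 1) (n : ℕ) (τ t : ℝ) :
    HasSum (fun k : ℕ => q ^ k * Real.cos (((k + n : ℕ) : ℝ) * t + τ)) (poissonKernel q n τ t) := by
  have h := (hasSum_geometric_of_norm_lt_one (ξ := (q : ℂ) * Complex.exp (t * Complex.I))
    (by rwa [norm_ofReal_mul_exp hq])).mul_left (Complex.exp (((n * t + τ : ℝ) : ℂ) * Complex.I))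
  have h2 := Complex.hasSum_re h
  unfold poissonKernel
  convert h2 using 1
  ext k
  rw [mul_pow, ← Complex.exp_nat_mul, mul_left_comm, ← Complex.exp_add, ← Complex.ofReal_pow,
    Complex.re_ofReal_mul]
  congr 1
  rw [← Complex.exp_ofReal_mul_I_re]
  congr 2
  push_cast; ring

/-- The two series have the same cosines, and all the differences of weights are nonnegative, so
their sum bounds the difference of the kernels uniformly in `t`. -/
lemma abs_tailKernel_sub_poissonKernel_le {r : ℝ} (hr : 2 ≤ r) {n : ℕ} (hn : 1 ≤ n) (β t : ℝ) :
    |(n : ℝ) ^ r * tailKernel n r β t -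
      poissonKernel (Real.exp (-r / n)) n (-(β * Real.pi / 2)) t| ≤ 64 * (n / r ^ 2) := by
  have hn' : (0 : ℝ) < n := by exact_mod_cast hn
  set q := Real.exp (-r / n) with hq
  have hq1 : q < 1 := by
    rw [hq, Real.exp_lt_one_iff, neg_div, neg_lt_zero]; positivity
  have hu := hasSum_poissonKernel (Real.exp_pos _).le hq1 n (-(β * Real.pi / 2)) t
  have hB : Summable fun k : ℕ => ((k + n : ℕ) : ℝ) ^ (-r) *
      Real.cos (((k + n : ℕ) : ℝ) * t - β * Real.pi / 2) :=
    Summable.of_norm_bounded (summable_tail_weights (by linarith) n)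
      (fun k => norm_tail_term_le n k r _)
  have hD := (hB.hasSum.mul_left ((n : ℝ) ^ r)).sub hu
  have ha : ∀ k : ℕ, 0 ≤ (1 + (k : ℝ) / n) ^ (-r) - Real.exp (-(r * (k / n))) := fun k =>
    sub_nonneg.2 (exp_neg_mul_le_rpow (by linarith) (by positivity))
  have hterm : ∀ k : ℕ, (n : ℝ) ^ r * (((k + n : ℕ) : ℝ) ^ (-r) *
      Real.cos (((k + n : ℕ) : ℝ) * t - β * Real.pi / 2)) -
      q ^ k * Real.cos (((k + n : ℕ) : ℝ) * t + -(β * Real.pi / 2)) =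
      ((1 + (k : ℝ) / n) ^ (-r) - Real.exp (-(r * (k / n)))) *
        Real.cos (((k + n : ℕ) : ℝ) * t - β * Real.pi / 2) := by
    intro k
    have e1 : (n : ℝ) ^ r * ((k + n : ℕ) : ℝ) ^ (-r) = (1 + (k : ℝ) / n) ^ (-r) := by
      have : 1 + (k : ℝ) / n = ((k + n : ℕ) : ℝ) / n := by push_cast; field_simp; ring
      rw [this, Real.div_rpow (by positivity) hn'.le, Real.rpow_neg hn'.le, div_inv_eq_mul,
        mul_comm]
    have e2 : q ^ k = Real.exp (-(r * (k / n))) := by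
      rw [hq, ← Real.exp_nat_mul]; congr 1; ring
    rw [← mul_assoc, e1, e2, ← sub_eq_add_neg]; ring
  rw [← hq, funext hterm] at hD
  have hsum := summable_of_sum_range_le ha (sum_rpow_sub_exp_le hr hn)
  have htsum := hsum.tsum_le_of_sum_range_le (sum_rpow_sub_exp_le hr hn)
  rw [tailKernel, ← hD.tsum_eq, ← Real.norm_eq_abs]
  refine (norm_tsum_le_tsum_norm ?_).trans (le_trans ?_ htsum)
  · refine Summable.of_nonneg_of_le (fun k => norm_nonneg _) (fun k => ?_) hsum
    rw [norm_mul, Real.norm_of_nonneg (ha k)]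
    exact mul_le_of_le_one_right (ha k) (Real.abs_cos_le_one _)
  · have hle : ∀ k : ℕ, ‖((1 + (k : ℝ) / n) ^ (-r) - Real.exp (-(r * (k / n)))) *
        Real.cos (((k + n : ℕ) : ℝ) * t - β * Real.pi / 2)‖ ≤
        (1 + (k : ℝ) / n) ^ (-r) - Real.exp (-(r * (k / n))) := fun k => by
      rw [norm_mul, Real.norm_of_nonneg (ha k)]
      exact mul_le_of_le_one_right (ha k) (Real.abs_cos_le_one _)
    exact (Summable.of_nonneg_of_le (fun k => norm_nonneg _) hle hsum).tsum_le_tsum hle hsum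

lemma one_sub_le_norm {q : ℝ} (hq : 0 ≤ q) (t : ℝ) :
    1 - q ≤ ‖1 - (q : ℂ) * Complex.exp (t * Complex.I)‖ := by
  have := norm_sub_norm_le (1 : ℂ) ((q : ℂ) * Complex.exp (t * Complex.I))
  rwa [norm_ofReal_mul_exp hq, norm_one] at this

lemma one_sub_ne_zero {q : ℝ} (hq : 0 ≤ q) (hq1 : q < 1) (t : ℝ) :
    1 - (q : ℂ) * Complex.exp (t * Complex.I) ≠ 0 := by
  rw [← norm_pos_iff]
  linarith [one_sub_le_norm hq t]

lemma norm_inv_one_sub_le {q : ℝ} (hq : 0 ≤ q) (hq1 : q < 1) (t : ℝ) :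
    ‖(1 - (q : ℂ) * Complex.exp (t * Complex.I))⁻¹‖ ≤ (1 - q)⁻¹ := by
  rw [norm_inv]
  exact inv_anti₀ (by linarith) (one_sub_le_norm hq t)

lemma continuous_inv_one_sub {q : ℝ} (hq : 0 ≤ q) (hq1 : q < 1) :
    Continuous fun t : ℝ => (1 - (q : ℂ) * Complex.exp (t * Complex.I))⁻¹ :=
  Continuous.inv₀ (by fun_prop) (one_sub_ne_zero hq hq1)

lemma continuous_poissonKernel {q : ℝ} (hq : 0 ≤ q) (hq1 : q < 1) (n : ℕ) :
    Continuous fun x : ℝ × ℝ => poissonKernel q n x.1 x.2 := by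
  unfold poissonKernel
  refine Complex.continuous_re.comp (Continuous.mul (by fun_prop) ?_)
  exact (continuous_inv_one_sub hq hq1).comp continuous_snd

lemma continuous_poissonKernel_right {q : ℝ} (hq : 0 ≤ q) (hq1 : q < 1) (n : ℕ) (τ : ℝ) :
    Continuous (poissonKernel q n τ) :=
  (continuous_poissonKernel hq hq1 n).comp (Continuous.prodMk_right τ)

lemma periodic_poissonKernel (q : ℝ) (n : ℕ) (τ : ℝ) :
    Function.Periodic (poissonKernel q n τ) (2 * Real.pi) := by
  intro t
  unfold poissonKernel
  have h1 : Complex.exp (((t + 2 * Real.pi : ℝ) : ℂ) * Complex.I) =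
      Complex.exp (t * Complex.I) := by
    rw [← Complex.exp_periodic (t * Complex.I)]; congr 1; push_cast; ring
  have h2 : Complex.exp (((n * (t + 2 * Real.pi) + τ : ℝ) : ℂ) * Complex.I) =
      Complex.exp (((n * t + τ : ℝ) : ℂ) * Complex.I) := by
    rw [← Complex.exp_periodic.nat_mul n (((n * t + τ : ℝ) : ℂ) * Complex.I)]; congr 1; push_cast; ring
  rw [h1, h2]

/-- A small translation acts on the kernel as a phase shift, up to a uniformly small error. -/
lemma abs_poissonKernel_shift_sub_le {q : ℝ} (hq : 0 ≤ q) (hq1 : q < 1) (n : ℕ) (τ σ t : ℝ) :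
    |poissonKernel q n τ (t + σ) - poissonKernel q n (τ + n * σ) t| ≤ |σ| * ((1 - q)⁻¹) ^ 2 := by
  unfold poissonKernel
  rw [← Complex.sub_re, show ((n * (t + σ) + τ : ℝ) : ℂ) = ((n * t + (τ + n * σ) : ℝ) : ℂ) by
    push_cast; ring, ← mul_sub]
  refine (Complex.abs_re_le_norm _).trans ?_
  rw [norm_mul, Complex.norm_exp_ofReal_mul_I, one_mul,
    inv_sub_inv (one_sub_ne_zero hq hq1 _) (one_sub_ne_zero hq hq1 _), div_eq_mul_inv, norm_mul,
    mul_inv, norm_mul, sq]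
  refine mul_le_mul ?_ (mul_le_mul (norm_inv_one_sub_le hq hq1 _) (norm_inv_one_sub_le hq hq1 _)
    (norm_nonneg _) (inv_nonneg.2 (by linarith))) (by positivity) (abs_nonneg _)
  have e : 1 - (q : ℂ) * Complex.exp (t * Complex.I) -
      (1 - (q : ℂ) * Complex.exp (((t + σ : ℝ) : ℂ) * Complex.I)) =
      (q : ℂ) * Complex.exp (t * Complex.I) * (Complex.exp (Complex.I * σ) - 1) := by
    rw [Complex.ofReal_add, add_mul, Complex.exp_add, mul_comm (σ : ℂ)]; ring
  rw [e, norm_mul, norm_ofReal_mul_exp hq]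
  calc _ ≤ 1 * ‖σ‖ := mul_le_mul hq1.le Real.norm_exp_I_mul_ofReal_sub_one_le
        (norm_nonneg _) zero_le_one
    _ = _ := by rw [one_mul]; rfl

/-! ### Parseval's identity and the hypergeometric function -/

lemma integral_exp_int_mul_I (m : ℤ) :
    ∫ t : ℝ, Complex.exp (m * (t * Complex.I)) ∂periodMeasure = if m = 0 then 2 * Real.pi else 0 := by
  split_ifs with h
  · subst h
    simp [periodMeasure_real_univ]
  · have e : ∀ t : ℝ, Complex.exp (m * (t * Complex.I)) =
        ((Real.cos (m * t) : ℝ) : ℂ) + ((Real.sin (m * t) : ℝ) : ℂ) * Complex.I := by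
      intro t
      rw [Complex.ofReal_cos, Complex.ofReal_sin, ← Complex.exp_mul_I]
      push_cast; ring_nf
    simp_rw [e]
    rw [integral_add (integrable_of_continuous (by fun_prop))
      (integrable_of_continuous (by fun_prop)), integral_mul_const, integral_complex_ofReal,
      integral_complex_ofReal, integral_cos_int_mul h, integral_sin_mul]
    simp

/-- Termwise integration of an absolutely convergent exponential series against a weight. -/
lemma integral_expSeries_mul {c : ℕ → ℝ} (hc : Summable fun k => |c k|) {w : ℝ → ℂ}
    (hw : Continuous w) {C : ℝ} (hC : ∀ t, ‖w t‖ ≤ C) :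
    ∫ t : ℝ, (∑' k : ℕ, c k * Complex.exp (k * (t * Complex.I))) * w t ∂periodMeasure =
      ∑' k : ℕ, c k * ∫ t : ℝ, Complex.exp (k * (t * Complex.I)) * w t ∂periodMeasure := by
  set F : ℕ → ℝ → ℂ := fun k t => c k * Complex.exp (k * (t * Complex.I)) * w t with hF
  have hFc : ∀ k, Continuous (F k) := fun k => by simp only [hF]; fun_prop
  have hC0 : 0 ≤ C := (norm_nonneg _).trans (hC 0)
  have hFb : ∀ k t, ‖F k t‖ ≤ |c k| * C := by
    intro k t
    have : ‖Complex.exp (k * (t * Complex.I))‖ = 1 := by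
      rw [← mul_assoc, ← Complex.ofReal_natCast, ← Complex.ofReal_mul,
        Complex.norm_exp_ofReal_mul_I]
    simp only [hF, norm_mul, this, mul_one, Complex.norm_real, Real.norm_eq_abs]
    exact mul_le_mul_of_nonneg_left (hC t) (abs_nonneg _)
  have hint : ∀ k, Integrable (F k) periodMeasure := fun k => integrable_of_continuous (hFc k)
  have hsum : Summable fun k => ∫ t, ‖F k t‖ ∂periodMeasure := by
    refine Summable.of_nonneg_of_le (fun k => integral_nonneg fun t => norm_nonneg _) (fun k => ?_)
      (hc.mul_right C |>.mul_left (2 * Real.pi))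
    calc ∫ t, ‖F k t‖ ∂periodMeasure ≤ ∫ t, (|c k| * C) ∂periodMeasure :=
          integral_mono (hint k).norm (integrable_const _) (hFb k)
      _ = _ := by simp [periodMeasure_real_univ]
  have key := hasSum_integral_of_summable_integral_norm hint hsum
  simp_rw [← tsum_mul_right]
  rw [← key.tsum_eq]
  congr 1; ext k
  rw [← integral_const_mul]
  simp only [hF, mul_assoc]

lemma continuous_expSeries {c : ℕ → ℝ} (hc : Summable fun k => |c k|) :
    Continuous fun t : ℝ => ∑' k : ℕ, (c k : ℂ) * Complex.exp (k * (t * Complex.I)) := by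
  refine continuous_tsum (fun k => by fun_prop) hc fun k t => ?_
  rw [norm_mul, ← mul_assoc, ← Complex.ofReal_natCast, ← Complex.ofReal_mul,
        Complex.norm_exp_ofReal_mul_I, Complex.norm_real, mul_one]
  rfl

open ComplexConjugate in
/-- Parseval's identity for an absolutely convergent one-sided series with real coefficients. -/
lemma integral_norm_sq_expSeries {c : ℕ → ℝ} (hc : Summable fun k => |c k|) :
    ∫ t : ℝ, ‖∑' k : ℕ, (c k : ℂ) * Complex.exp (k * (t * Complex.I))‖ ^ 2 ∂periodMeasure =
      2 * Real.pi * ∑' k, c k ^ 2 := by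
  set G : ℝ → ℂ := fun t => ∑' k : ℕ, (c k : ℂ) * Complex.exp (k * (t * Complex.I)) with hG
  have hGc : Continuous G := continuous_expSeries hc
  have hterm : ∀ k (t : ℝ), ‖(c k : ℂ) * Complex.exp (k * (t * Complex.I))‖ = |c k| := by
    intro k t
    rw [norm_mul, ← mul_assoc, ← Complex.ofReal_natCast, ← Complex.ofReal_mul,
        Complex.norm_exp_ofReal_mul_I, Complex.norm_real, mul_one]
    rfl
  have hGb : ∀ t, ‖conj (G t)‖ ≤ ∑' k, |c k| := by
    intro t
    rw [RCLike.norm_conj]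
    refine (norm_tsum_le_tsum_norm ?_).trans (le_of_eq ?_)
    · simpa only [hterm] using hc
    · simp_rw [hterm]
  have hcoef : ∀ j : ℕ, ∫ t : ℝ, Complex.exp (j * (t * Complex.I)) * conj (G t) ∂periodMeasure =
      2 * Real.pi * c j := by
    intro j
    have h1 := integral_expSeries_mul hc (w := fun t => Complex.exp (-(j * (t * Complex.I))))
      (by fun_prop) (C := 1) (fun t => by
        rw [← mul_assoc, ← neg_mul, ← Complex.ofReal_natCast, ← Complex.ofReal_mul,
          ← Complex.ofReal_neg, Complex.norm_exp_ofReal_mul_I])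
    have h2 : ∀ k : ℕ, ∫ t : ℝ, Complex.exp (k * (t * Complex.I)) *
        Complex.exp (-(j * (t * Complex.I))) ∂periodMeasure =
        if k = j then 2 * Real.pi else 0 := by
      intro k
      have := integral_exp_int_mul_I (k - j)
      simp only [sub_eq_zero, Nat.cast_inj] at this
      rw [← this]
      congr 1; ext t
      rw [← Complex.exp_add]; push_cast; ring_nf
    simp_rw [h2] at h1
    rw [tsum_eq_single j (by intro b hb; simp [hb])] at h1
    -- The coefficients are real, so conjugation turns the coefficient formula for `G` into the one
    -- needed for `conj G`.
    have h3 := congrArg conj h1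
    rw [← integral_conj] at h3
    simp only [map_mul, ← Complex.exp_conj, map_neg, Complex.conj_ofReal, Complex.conj_I,
      Complex.conj_natCast, mul_neg, neg_neg, if_true] at h3
    push_cast at h3
    rw [mul_comm _ (c j : ℂ), ← h3]
    congr 1; ext t
    rw [mul_comm]
  have h := integral_expSeries_mul hc (w := fun t => conj (G t)) (by fun_prop) hGb
  simp_rw [hcoef] at h
  have h4 : ∀ t : ℝ, (∑' k : ℕ, (c k : ℂ) * Complex.exp (k * (t * Complex.I))) * conj (G t) =
      ((‖G t‖ ^ 2 : ℝ) : ℂ) := by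
    intro t
    rw [Complex.ofReal_pow]
    exact Complex.mul_conj' (G t)
  simp_rw [h4] at h
  rw [integral_complex_ofReal] at h
  apply Complex.ofReal_injective
  refine h.trans ?_
  push_cast
  rw [← tsum_mul_left]
  congr 1; ext k
  ring

lemma choose_eq_ascPochhammer (a : ℝ) (k : ℕ) :
    Ring.choose (a + k - 1) k = (ascPochhammer ℝ k).eval a / k.factorial := by
  have h := Ring.factorial_nsmul_multichoose_eq_ascPochhammer a k
  have h2 : Ring.multichoose a k = Ring.choose (a + k - 1) k := by
    rw [Ring.choose]; congr 1; ring
  rw [← h2, eq_div_iff (by positivity), mul_comm, ← nsmul_eq_mul, h,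
    Polynomial.ascPochhammer_smeval_eq_eval]

lemma hasSum_one_div_one_sub_cpow (a : ℝ) {z : ℂ} (hz : ‖z‖ < 1) :
    HasSum (fun k : ℕ => (((ascPochhammer ℝ k).eval a / k.factorial : ℝ) : ℂ) * z ^ k)
      (1 / (1 - z) ^ (a : ℂ)) := by
  have hz' : ‖z‖ₑ < 1 := by rwa [← ofReal_norm, ENNReal.ofReal_lt_one]
  have h := (Complex.one_div_one_sub_cpow_hasFPowerSeriesOnBall_zero (a : ℂ)).hasSum
    (y := z) (by simpa using hz')
  simp only [FormalMultilinearSeries.ofScalars_apply_eq, zero_add, smul_eq_mul] at h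
  have e : (fun k : ℕ => (((ascPochhammer ℝ k).eval a / k.factorial : ℝ) : ℂ) * z ^ k) =
      fun k : ℕ => Ring.choose ((a : ℂ) + k - 1) k * z ^ k := by
    ext k
    rw [← choose_eq_ascPochhammer, Complex.ofReal_choose]
    push_cast; rfl
  rw [e]
  exact h

/-- The integrand is `|(1 - z)^{-s/2}|²` with `z = q e^{it}`. The binomial series has coefficients
`(s/2)_k / k!`; Parseval squares them, and `(1)_k = k!` identifies the sum. -/
lemma integral_norm_inv_rpow {q s : ℝ} (hq : 0 ≤ q) (hq1 : q < 1) :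
    ∫ t : ℝ, ‖(1 - (q : ℂ) * Complex.exp (t * Complex.I))⁻¹‖ ^ s ∂periodMeasure =
      2 * Real.pi * ordinaryHypergeometric (s / 2) (s / 2) (1 : ℝ) (q ^ 2) := by
  set c : ℕ → ℝ := fun k => (ascPochhammer ℝ k).eval (s / 2) / k.factorial * q ^ k with hc
  have hsum : Summable fun k => |c k| := by
    have h := (hasSum_one_div_one_sub_cpow (s / 2) (z := (q : ℂ))
      (by rwa [Complex.norm_of_nonneg hq])).summable.norm
    refine h.congr fun k => ?_
    rw [← Complex.ofReal_pow, ← Complex.ofReal_mul, Complex.norm_real, Real.norm_eq_abs]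
  have hG : ∀ t : ℝ, ‖(1 - (q : ℂ) * Complex.exp (t * Complex.I))⁻¹‖ ^ s =
      ‖∑' k : ℕ, (c k : ℂ) * Complex.exp (k * (t * Complex.I))‖ ^ 2 := by
    intro t
    have h := hasSum_one_div_one_sub_cpow (s / 2) (z := (q : ℂ) * Complex.exp (t * Complex.I))
      (by rwa [norm_ofReal_mul_exp hq])
    have e : ∀ k : ℕ, (((ascPochhammer ℝ k).eval (s / 2) / k.factorial : ℝ) : ℂ) *
        ((q : ℂ) * Complex.exp (t * Complex.I)) ^ k =
        (c k : ℂ) * Complex.exp (k * (t * Complex.I)) := by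
      intro k
      rw [mul_pow, ← Complex.exp_nat_mul]
      simp only [hc]; push_cast; ring
    rw [funext e] at h
    -- The exponent is real, so the norm of the complex power depends only on the modulus of the
    -- base, not on its argument.
    rw [h.tsum_eq, norm_div, norm_one, Complex.norm_cpow_real, norm_inv, one_div, inv_pow,
      Real.inv_rpow (norm_nonneg _), ← Real.rpow_mul_natCast (norm_nonneg _)]
    congr 2; push_cast; ring
  simp_rw [hG]
  rw [integral_norm_sq_expSeries hsum, ordinaryHypergeometric_eq_tsum]
  congr 2; ext k
  rw [ascPochhammer_eval_one]
  simp only [hc, smul_eq_mul]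
  field_simp
  ring

/-! ### Norm of the Poisson-type kernel by averaging over the phase -/

/-- A rotation of the phase, averaged over a period, decouples modulus and oscillation. -/
lemma integral_abs_re_rpow {s : ℝ} (τ₀ : ℝ) (z : ℂ) :
    ∫ τ : ℝ, |(Complex.exp (((τ₀ + τ : ℝ) : ℂ) * Complex.I) * z).re| ^ s ∂periodMeasure =
      ‖z‖ ^ s * ∫ t, |Real.cos t| ^ s ∂periodMeasure := by
  have e : ∀ τ : ℝ, |(Complex.exp (((τ₀ + τ : ℝ) : ℂ) * Complex.I) * z).re| ^ s =
      ‖z‖ ^ s * |Real.cos (τ + (τ₀ + z.arg))| ^ s := by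
    intro τ
    have : (Complex.exp (((τ₀ + τ : ℝ) : ℂ) * Complex.I) * z).re =
        ‖z‖ * Real.cos (τ + (τ₀ + z.arg)) := by
      conv_lhs => rw [← Complex.norm_mul_exp_arg_mul_I z]
      rw [mul_left_comm, ← Complex.exp_add, ← add_mul, ← Complex.ofReal_add,
        Complex.re_ofReal_mul, Complex.exp_ofReal_mul_I_re]
      congr 2; ring
    rw [this, abs_mul, abs_of_nonneg (norm_nonneg z), Real.mul_rpow (norm_nonneg _) (abs_nonneg _)]
  simp_rw [e]
  rw [integral_const_mul]
  congr 1
  have hper : Function.Periodic (fun t => |Real.cos t| ^ s) (2 * Real.pi) := fun t => by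
    simp only [Real.cos_add_two_pi]
  exact integral_shift hper _

lemma abs_poissonKernel_le {q : ℝ} (hq : 0 ≤ q) (hq1 : q < 1) (n : ℕ) (τ t : ℝ) :
    |poissonKernel q n τ t| ≤ (1 - q)⁻¹ := by
  unfold poissonKernel
  refine (Complex.abs_re_le_norm _).trans ?_
  rw [norm_mul, Complex.norm_exp_ofReal_mul_I, one_mul]
  exact norm_inv_one_sub_le hq hq1 t

lemma integrable_poissonKernel_rpow {q : ℝ} (hq : 0 ≤ q) (hq1 : q < 1) (n : ℕ) (τ₀ : ℝ) {s : ℝ}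
    (hs : 0 ≤ s) :
    Integrable (Function.uncurry fun τ t => |poissonKernel q n (τ₀ + τ) t| ^ s)
      (periodMeasure.prod periodMeasure) := by
  have hc : Continuous (Function.uncurry fun τ t => |poissonKernel q n (τ₀ + τ) t| ^ s) := by
    have h1 : Continuous fun x : ℝ × ℝ => poissonKernel q n (τ₀ + x.1) x.2 :=
      (continuous_poissonKernel hq hq1 n).comp
        (g := fun x : ℝ × ℝ => poissonKernel q n x.1 x.2) (f := fun x : ℝ × ℝ => (τ₀ + x.1, x.2))
        (by fun_prop)
    exact h1.abs.rpow_const fun x => Or.inr hs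
  refine Integrable.of_bound hc.aestronglyMeasurable (((1 - q)⁻¹) ^ s)
    (Filter.Eventually.of_forall fun x => ?_)
  rw [Function.uncurry, Real.norm_of_nonneg (by positivity)]
  exact Real.rpow_le_rpow (abs_nonneg _) (abs_poissonKernel_le hq hq1 n _ _) hs

/-- The average over the phase of the `s`-th power of the norm. -/
lemma integral_integral_poissonKernel_rpow {q : ℝ} (hq : 0 ≤ q) (hq1 : q < 1) (n : ℕ) (τ₀ : ℝ)
    {s : ℝ} (hs : 0 ≤ s) :
    ∫ τ, ∫ t, |poissonKernel q n (τ₀ + τ) t| ^ s ∂periodMeasure ∂periodMeasure =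
      2 * Real.pi * ((∫ t, |Real.cos t| ^ s ∂periodMeasure) *
        ordinaryHypergeometric (s / 2) (s / 2) (1 : ℝ) (q ^ 2)) := by
  rw [integral_integral_swap (integrable_poissonKernel_rpow hq hq1 n τ₀ hs)]
  have e : ∀ t : ℝ, ∫ τ, |poissonKernel q n (τ₀ + τ) t| ^ s ∂periodMeasure =
      ‖(1 - (q : ℂ) * Complex.exp (t * Complex.I))⁻¹‖ ^ s *
        ∫ t, |Real.cos t| ^ s ∂periodMeasure := by
    intro t
    rw [← integral_abs_re_rpow (n * t + τ₀)]
    simp only [poissonKernel, add_assoc]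
  simp_rw [e]
  rw [integral_mul_const, integral_norm_inv_rpow hq hq1]
  ring

/-- Translation by `τ / n` preserves the norm and acts as the phase change `τ`; the small step `|τ|
/ n ≤ π / n` makes the error small. -/
lemma abs_realNorm_poissonKernel_sub_le {q : ℝ} (hq : 0 ≤ q) (hq1 : q < 1) {n : ℕ} (hn : 1 ≤ n)
    {p : ℝ≥0∞} (hp : 1 ≤ p) (τ₀ : ℝ) {τ : ℝ} (hτ : |τ| ≤ Real.pi) :
    |realNorm p (poissonKernel q n τ₀) - realNorm p (poissonKernel q n (τ₀ + τ))| ≤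
      2 * Real.pi * (Real.pi / n * ((1 - q)⁻¹) ^ 2) := by
  have hn' : (0 : ℝ) < n := by exact_mod_cast hn
  have hc := continuous_poissonKernel_right hq hq1 n τ₀
  rw [← realNorm_shift (periodic_poissonKernel q n τ₀) hc p (τ / n)]
  refine abs_realNorm_sub_le hp (by fun_prop)
    (continuous_poissonKernel_right hq hq1 n (τ₀ + τ)) fun t => ?_
  have h := abs_poissonKernel_shift_sub_le hq hq1 n τ₀ (τ / n) t
  rw [mul_div_cancel₀ τ hn'.ne'] at h
  refine h.trans ?_
  rw [abs_div, abs_of_pos hn']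
  gcongr

/-- The norms `Y τ` at all phases lie within `η` of `X`, and the mean of `Y^s` is exactly `T^s`.
Hence `T` lies within `η` of `X`, with no loss depending on `s`. -/
lemma abs_realNorm_poissonKernel_sub_main_le {q : ℝ} (hq : 0 ≤ q) (hq1 : q < 1) {n : ℕ}
    (hn : 1 ≤ n) {p : ℝ≥0∞} (hp : 1 ≤ p) (hpt : p ≠ ⊤) (τ₀ : ℝ) :
    |realNorm p (poissonKernel q n τ₀) - realNorm p Real.cos *
      ordinaryHypergeometric (p.toReal / 2) (p.toReal / 2) (1 : ℝ) (q ^ 2) ^ (1 / p.toReal)| ≤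
      2 * Real.pi * (Real.pi / n * ((1 - q)⁻¹) ^ 2) := by
  set η := 2 * Real.pi * (Real.pi / n * ((1 - q)⁻¹) ^ 2) with hη
  set s := p.toReal with hs
  have hs0 : 0 < s := ENNReal.toReal_pos (zero_lt_one.trans_le hp).ne' hpt
  set H := ordinaryHypergeometric (s / 2) (s / 2) (1 : ℝ) (q ^ 2) with hH
  have hη0 : 0 ≤ η := by positivity
  have hH0 : 0 ≤ H := by
    have h := integral_norm_inv_rpow (s := s) hq hq1
    have h2 : 0 ≤ 2 * Real.pi * H := by
      rw [← h]; exact integral_nonneg fun t => by positivity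
    exact nonneg_of_mul_nonneg_right h2 Real.two_pi_pos
  set T := realNorm p Real.cos * H ^ (1 / s) with hT
  have hT0 : 0 ≤ T := mul_nonneg (realNorm_nonneg _ _) (by positivity)
  have hTs : T ^ s = (∫ t, |Real.cos t| ^ s ∂periodMeasure) * H := by
    rw [hT, Real.mul_rpow (realNorm_nonneg _ _) (by positivity),
      realNorm_rpow_toReal (memLp_of_continuous Real.continuous_cos p) hp hpt,
      ← Real.rpow_mul hH0, one_div, inv_mul_cancel₀ hs0.ne', Real.rpow_one]
  set X := realNorm p (poissonKernel q n τ₀) with hX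
  set Y : ℝ → ℝ := fun τ => realNorm p (poissonKernel q n (τ₀ + τ)) with hY
  have hYs : ∀ τ, Y τ ^ s = ∫ t, |poissonKernel q n (τ₀ + τ) t| ^ s ∂periodMeasure := fun τ =>
    realNorm_rpow_toReal (memLp_of_continuous (continuous_poissonKernel_right hq hq1 n _) p) hp hpt
  have hYint : ∫ τ, Y τ ^ s ∂periodMeasure = 2 * Real.pi * T ^ s := by
    simp_rw [hYs]
    rw [integral_integral_poissonKernel_rpow hq hq1 n τ₀ hs0.le, hTs]
  have hYi : Integrable (fun τ => Y τ ^ s) periodMeasure := by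
    simp_rw [hYs]
    exact (integrable_poissonKernel_rpow hq hq1 n τ₀ hs0.le).integral_prod_left
  have hXY : ∀ᵐ τ ∂periodMeasure, |X - Y τ| ≤ η := by
    unfold periodMeasure
    filter_upwards [ae_restrict_mem measurableSet_Ico] with τ hτ
    exact abs_realNorm_poissonKernel_sub_le hq hq1 hn hp τ₀ (abs_le.2 ⟨hτ.1, hτ.2.le⟩)
  have hX0 : 0 ≤ X := realNorm_nonneg _ _
  have hconst : ∀ a : ℝ, ∫ _ : ℝ, a ∂periodMeasure = 2 * Real.pi * a := fun a => by
    simp [periodMeasure_real_univ]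
  rw [abs_le]
  constructor
  · have h1 : 2 * Real.pi * T ^ s ≤ 2 * Real.pi * (X + η) ^ s := by
      rw [← hYint, ← hconst]
      refine integral_mono_ae hYi (integrable_const _) ?_
      filter_upwards [hXY] with τ hτ
      exact Real.rpow_le_rpow (realNorm_nonneg _ _) (by linarith [(abs_le.1 hτ).1]) hs0.le
    have h2 := (Real.rpow_le_rpow_iff hT0 (by positivity) hs0).1
      (le_of_mul_le_mul_left h1 Real.two_pi_pos)
    linarith
  -- If `X ≤ η` then `T ≥ 0` suffices; otherwise `X - η` is positive and powers can be compared.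
  · rcases le_or_gt X η with h | h
    · linarith
    have h1 : 2 * Real.pi * (X - η) ^ s ≤ 2 * Real.pi * T ^ s := by
      rw [← hYint, ← hconst]
      refine integral_mono_ae (integrable_const _) hYi ?_
      filter_upwards [hXY] with τ hτ
      exact Real.rpow_le_rpow (by linarith) (by linarith [(abs_le.1 hτ).2]) hs0.le
    have h2 := (Real.rpow_le_rpow_iff (by linarith) hT0 hs0).1
      (le_of_mul_le_mul_left h1 Real.two_pi_pos)
    linarith

/-- A larger value at `0` would persist on an open set, hence on a set of positive measure. -/
lemma abs_apply_zero_le_realNorm_top {h : ℝ → ℝ} (hc : Continuous h) :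
    |h 0| ≤ realNorm ⊤ h := by
  by_contra! hlt
  have hae : ∀ᵐ t ∂periodMeasure, |h t| ≤ realNorm ⊤ h := by
    have h1 := ae_le_eLpNormEssSup (μ := periodMeasure) (f := h)
    filter_upwards [h1] with t ht
    have h2 := ENNReal.toReal_mono (a := ‖h t‖ₑ) (b := periodNorm ⊤ h) (periodNorm_ne_top hc ⊤)
      ht
    simpa [realNorm] using h2
  have hopen : IsOpen ({t | realNorm ⊤ h < |h t|} ∩ Set.Ioo (-Real.pi) Real.pi) :=
    (isOpen_lt continuous_const hc.abs).inter isOpen_Ioo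
  have hpos := hopen.measure_pos volume ⟨0, hlt, by simp [Real.pi_pos]⟩
  have hzero : volume ({t | realNorm ⊤ h < |h t|} ∩ Set.Ico (-Real.pi) Real.pi) = 0 := by
    rw [ae_iff] at hae
    simp only [not_le] at hae
    unfold periodMeasure at hae
    rwa [Measure.restrict_apply (isOpen_lt continuous_const hc.abs).measurableSet] at hae
  exact hpos.ne' (measure_mono_null
    (Set.inter_subset_inter_right _ Set.Ioo_subset_Ico_self) hzero)

/-- The upper bound is pointwise and holds at every phase. For the lower bound one phase attains
`1/(1-q)` at the origin, and the phase comparison transfers this to `τ₀`. -/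
lemma abs_realNorm_top_poissonKernel_sub_le {q : ℝ} (hq : 0 ≤ q) (hq1 : q < 1) {n : ℕ}
    (hn : 1 ≤ n) (τ₀ : ℝ) :
    |realNorm ⊤ (poissonKernel q n τ₀) - (1 - q)⁻¹| ≤
      2 * Real.pi * (Real.pi / n * ((1 - q)⁻¹) ^ 2) := by
  have hM : 0 ≤ (1 - q)⁻¹ := inv_nonneg.2 (by linarith)
  have hη0 : 0 ≤ 2 * Real.pi * (Real.pi / n * ((1 - q)⁻¹) ^ 2) := by positivity
  have hup : realNorm ⊤ (poissonKernel q n τ₀) ≤ (1 - q)⁻¹ := by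
    refine ENNReal.toReal_le_of_le_ofReal hM ?_
    rw [periodNorm_eq, eLpNorm_exponent_top]
    exact eLpNormEssSup_le_of_ae_bound
      (Filter.Eventually.of_forall fun t => abs_poissonKernel_le hq hq1 n τ₀ t)
  have hper : Function.Periodic (fun τ => Real.cos (τ₀ + τ)) (2 * Real.pi) := fun τ => by
    simp only [← add_assoc, Real.cos_add_two_pi]
  obtain ⟨τ, hτ, hcos⟩ := hper.exists_mem_Ico Real.two_pi_pos (-τ₀) (-Real.pi)
  simp only [add_neg_cancel, Real.cos_zero] at hcos
  have hτ' : |τ| ≤ Real.pi := abs_le.2 ⟨hτ.1, by linarith [hτ.2]⟩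
  have h0 : poissonKernel q n (τ₀ + τ) 0 = (1 - q)⁻¹ := by
    have e : (1 - (q : ℂ) * Complex.exp (((0 : ℝ) : ℂ) * Complex.I))⁻¹ = (((1 - q)⁻¹ : ℝ) : ℂ) := by
      simp
    rw [poissonKernel, e, mul_zero, zero_add, Complex.re_mul_ofReal, Complex.exp_ofReal_mul_I_re,
      ← hcos, one_mul]
  have h1 := abs_apply_zero_le_realNorm_top (continuous_poissonKernel_right hq hq1 n (τ₀ + τ))
  rw [h0, abs_of_nonneg hM] at h1
  have h2 := abs_le.1 (abs_realNorm_poissonKernel_sub_le hq hq1 hn (p := ⊤) le_top τ₀ hτ')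
  rw [abs_le]
  constructor <;> linarith [h2.1]

/-! ### Collecting the errors -/

/-- Since `e^{-r/n} ≤ n / (n + r)` and `n + r ≤ 3n`, one has `1 - q ≥ r / (3n)`. Here the upper
restriction on `r` enters. -/
lemma inv_one_sub_exp_sq_div_le {r : ℝ} (hr : 0 < r) {n : ℕ} (hn : 1 ≤ n) (hrn : r ≤ n + 1) :
    ((1 - Real.exp (-r / n))⁻¹) ^ 2 / n ≤ 9 * (n / r ^ 2) := by
  have hn1 : (1 : ℝ) ≤ n := by exact_mod_cast hn
  have hn' : (0 : ℝ) < n := by linarith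
  have h1 : Real.exp (-r / n) ≤ n / (n + r) := by
    rw [neg_div, Real.exp_neg, ← one_div, div_le_div_iff₀ (Real.exp_pos _) (by positivity), one_mul]
    have := Real.add_one_le_exp (r / n)
    calc (n : ℝ) + r = n * (r / n + 1) := by field_simp; ring
      _ ≤ _ := by gcongr
  have h2 : r / (3 * n) ≤ 1 - Real.exp (-r / n) := by
    have : r / (3 * n) ≤ r / (n + r) := by
      apply div_le_div_of_nonneg_left hr.le (by positivity); linarith
    have e : r / (n + r) = 1 - n / (n + r) := by field_simp; ring
    linarith
  have h3 : (1 - Real.exp (-r / n))⁻¹ ≤ 3 * n / r := by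
    rw [← inv_div r (3 * (n : ℝ))]; exact inv_anti₀ (by positivity) h2
  have h0 : 0 ≤ (1 - Real.exp (-r / n))⁻¹ := inv_nonneg.2 (le_trans (by positivity) h2)
  calc _ ≤ (3 * n / r) ^ 2 / n := by gcongr
    _ = _ := by field_simp; norm_num

/-- The error of Fourier sums agrees with any main term that approximates the norm of the
Poisson-type kernel uniformly in the phase. -/
lemma abs_fourierError_sub_le {p s : ℝ≥0∞} (hps : p.HolderConjugate s) (β : ℝ) {r : ℝ}
    (hr : 2 ≤ r) {n : ℕ} (hn : 1 ≤ n) (hrn : r ≤ n + 1) {W : ℝ}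
    (hW : ∀ τ, |realNorm s (poissonKernel (Real.exp (-r / n)) n τ) - W| ≤
      2 * Real.pi * (Real.pi / n * ((1 - Real.exp (-r / n))⁻¹) ^ 2)) :
    |(fourierError n (weylNagyClass r β p)).toReal * (n : ℝ) ^ r - W / Real.pi| ≤
      236 * (n / r ^ 2) := by
  have hn' : (0 : ℝ) < n := by exact_mod_cast hn
  have hpi := Real.pi_pos
  have hs1 : 1 ≤ s := hps.symm.one_le
  set q := Real.exp (-r / n) with hq
  have hq0 : 0 ≤ q := (Real.exp_pos _).le
  have hq1 : q < 1 := by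
    rw [hq, Real.exp_lt_one_iff, neg_div, neg_lt_zero]; positivity
  set R := (n : ℝ) / r ^ 2 with hR
  have hR0 : 0 ≤ R := by positivity
  set ε := Real.pi / n * ((1 - q)⁻¹) ^ 2 with hε
  have hεR : ε ≤ 36 * R := by
    have h1 := inv_one_sub_exp_sq_div_le (by linarith) hn hrn
    calc ε = Real.pi * (((1 - q)⁻¹) ^ 2 / n) := by rw [hε]; ring
      _ ≤ 4 * (9 * R) := mul_le_mul Real.pi_le_four h1 (by positivity) (by norm_num)
      _ = _ := by ring
  obtain ⟨-, hU, hL⟩ := fourierError_bounds hps β (show 1 < r by linarith) hn (Real.pi / n)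
  set E := (fourierError n (weylNagyClass r β p)).toReal with hE
  set B := tailKernel n r β with hB
  set τ₀ := -(β * Real.pi / 2) with hτ₀
  set u := poissonKernel q n τ₀ with hu
  have hBc : Continuous B := continuous_tailKernel n (by linarith) β
  have huc : Continuous u := continuous_poissonKernel_right hq0 hq1 n τ₀
  have hnr : 0 < (n : ℝ) ^ r := Real.rpow_pos_of_pos hn' r
  have hBu : ∀ t, |(n : ℝ) ^ r * B t - u t| ≤ 64 * R := fun t =>
    abs_tailKernel_sub_poissonKernel_le hr hn β t
  have hWu := abs_le.1 (hW τ₀)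
  have hN := realNorm_le_add hs1 (by fun_prop) huc hBu
  rw [realNorm_const_mul, abs_of_pos hnr] at hN
  -- Replacing `n^r B` by `u` costs `64 R` at each of the two points, and the translation by `π / n`
  -- is a half-turn of the phase up to `ε`.
  have hN2 : realNorm s (fun t => 2 * u t) ≤
      realNorm s (fun t => (n : ℝ) ^ r * (B t - B (t + Real.pi / n))) +
        2 * Real.pi * (128 * R + ε) := by
    refine realNorm_le_add hs1 (by fun_prop) (by fun_prop) fun t => ?_
    have h1 := abs_le.1 (hBu t)
    have h2 := abs_le.1 (hBu (t + Real.pi / n))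
    have h3 := abs_poissonKernel_shift_sub_le hq0 hq1 n τ₀ (Real.pi / n) t
    have h4 : poissonKernel q n (τ₀ + n * (Real.pi / n)) t = - u t := by
      rw [mul_div_cancel₀ _ hn'.ne', hu, poissonKernel, poissonKernel, ← Complex.neg_re,
        ← neg_mul, ← Complex.exp_add_pi_mul_I]
      congr 3; push_cast; ring
    rw [h4, abs_of_pos (show 0 < Real.pi / (n : ℝ) by positivity), ← hε, ← hu] at h3
    have h5 := abs_le.1 h3
    rw [abs_le]
    constructor <;> linarith [h1.1, h1.2, h2.1, h2.2, h5.1, h5.2]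
  rw [realNorm_const_mul, realNorm_const_mul, abs_of_pos hnr, abs_of_pos two_pos] at hN2
  set NB := realNorm s B with hNB
  set ND := realNorm s (fun t => B t - B (t + Real.pi / n)) with hND
  have hU2 : E * (n : ℝ) ^ r * Real.pi ≤ (n : ℝ) ^ r * NB := by
    have := mul_le_mul_of_nonneg_right hU (mul_pos hnr hpi).le
    calc _ = E * ((n : ℝ) ^ r * Real.pi) := by ring
      _ ≤ _ := this
      _ = _ := by field_simp
  have hL2 : (n : ℝ) ^ r * ND ≤ 2 * (E * (n : ℝ) ^ r * Real.pi) := by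
    have := mul_le_mul_of_nonneg_right hL (mul_pos hnr hpi).le
    calc _ = 2 * (1 / Real.pi * (1 / 2 * ND) * ((n : ℝ) ^ r * Real.pi)) := by field_simp
      _ ≤ 2 * (E * ((n : ℝ) ^ r * Real.pi)) := by linarith
      _ = _ := by ring
  set X := E * (n : ℝ) ^ r with hX
  have hεp : Real.pi * ε ≤ Real.pi * (36 * R) := mul_le_mul_of_nonneg_left hεR hpi.le
  have hRp : 0 ≤ Real.pi * R := by positivity
  have e : X - W / Real.pi = (X * Real.pi - W) / Real.pi := by field_simp
  rw [e, abs_div, abs_of_pos hpi, div_le_iff₀ hpi, abs_le]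
  -- In units of `π R`, with `ε ≤ 36 R`: the upper side costs `128 + 2 · 36`, the lower side `128 +
  -- 3 · 36 = 236`.
  constructor <;> linarith [hWu.1, hWu.2]

end WeylNagy
end

theorem theorem1 :
    ∃ K : ℝ, ∀ (p p' : ℝ≥0∞) (β r : ℝ) (n : ℕ),
      1 ≤ p → 1 / p + 1 / p' = 1 → 1 < r → 1 ≤ n →
      Real.sqrt n + 1 ≤ r → r ≤ n + 1 →
      (∀ f ∈ WeylNagy.weylNagyClass r β p, Continuous f) ∧
      WeylNagy.fourierError n (WeylNagy.weylNagyClass r β p) ≠ ⊤ ∧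
      ∃ θ : ℝ, |θ| ≤ K ∧
        (p = 1 →
          (WeylNagy.fourierError n (WeylNagy.weylNagyClass r β p)).toReal =
            (n : ℝ) ^ (-r) *
              (1 / (Real.pi * (1 - Real.exp (-r / n))) + θ * (n * r ^ (-2 : ℝ)))) ∧
        (1 < p →
          (WeylNagy.fourierError n (WeylNagy.weylNagyClass r β p)).toReal =
            (n : ℝ) ^ (-r) * (WeylNagy.mainTerm p' r n + θ * (n * r ^ (-2 : ℝ)))) := by
  refine ⟨236, fun p p' β r n hp hpp' hr hn hsr hrn => ?_⟩
  have hps : p.HolderConjugate p' := by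
    rw [ENNReal.holderConjugate_iff, ← one_div, ← one_div]; exact hpp'
  have hn1 : (1 : ℝ) ≤ n := by exact_mod_cast hn
  have hn' : (0 : ℝ) < n := by linarith
  -- The lower restriction on `r` enters only through this bound.
  have hr2 : 2 ≤ r := by
    have := Real.one_le_sqrt.2 hn1
    linarith
  have hq0 : 0 ≤ Real.exp (-r / n) := (Real.exp_pos _).le
  have hq1 : Real.exp (-r / n) < 1 := by
    rw [Real.exp_lt_one_iff, neg_div, neg_lt_zero]; positivity
  have hcont : ∀ f ∈ WeylNagy.weylNagyClass r β p, Continuous f := by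
    rintro f ⟨-, a₀, φ, hφ, hf⟩
    exact WeylNagy.continuous_convolution hφ.1 (WeylNagy.integrable_of_mem_unitBall hp hφ) hr β a₀ hf
  refine ⟨hcont, (WeylNagy.fourierError_bounds hps β hr hn 0).1, ?_⟩
  set E := (WeylNagy.fourierError n (WeylNagy.weylNagyClass r β p)).toReal with hE
  have hnr : 0 < (n : ℝ) ^ r := Real.rpow_pos_of_pos hn' r
  have hR : (n : ℝ) * r ^ (-2 : ℝ) = n / r ^ 2 := by
    rw [Real.rpow_neg (by linarith), div_eq_mul_inv]; norm_cast
  have hRpos : 0 < (n : ℝ) / r ^ 2 := by positivity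
  have main : ∀ V : ℝ, |E * (n : ℝ) ^ r - V| ≤ 236 * (n / r ^ 2) → ∃ θ : ℝ, |θ| ≤ 236 ∧
      E = (n : ℝ) ^ (-r) * (V + θ * (n * r ^ (-2 : ℝ))) := by
    intro V hV
    refine ⟨(E * (n : ℝ) ^ r - V) / (n / r ^ 2), ?_, ?_⟩
    · rw [abs_div, abs_of_pos hRpos, div_le_iff₀ hRpos]; exact hV
    · rw [hR, div_mul_cancel₀ _ hRpos.ne', Real.rpow_neg hn'.le]
      field_simp
      ring
  rcases hp.eq_or_lt with hp1 | hp1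
  · have hp'top : p' = ⊤ := by
      subst hp1
      simpa using hpp'
    subst hp'top
    have h := WeylNagy.abs_fourierError_sub_le hps β hr2 hn hrn
      (WeylNagy.abs_realNorm_top_poissonKernel_sub_le hq0 hq1 hn)
    obtain ⟨θ, hθ, hEθ⟩ := main _ h
    refine ⟨θ, hθ, fun _ => ?_, fun h1 => absurd hp1 h1.ne⟩
    rw [hEθ, one_div, mul_inv, div_eq_inv_mul]
  · have hp'top : p' ≠ ⊤ := by
      rintro rfl
      have : p = 1 := by simpa using hpp'
      exact hp1.ne' this
    have h := WeylNagy.abs_fourierError_sub_le hps β hr2 hn hrn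
      (WeylNagy.abs_realNorm_poissonKernel_sub_main_le hq0 hq1 hn hps.symm.one_le hp'top)
    obtain ⟨θ, hθ, hEθ⟩ := main _ h
    refine ⟨θ, hθ, fun h1 => absurd h1 hp1.ne', fun _ => ?_⟩
    rw [hEθ]
    congr 2
    rw [WeylNagy.mainTerm, ← Real.exp_nat_mul, WeylNagy.realNorm]
    have e : ((2 : ℕ) : ℝ) * (-r / n) = -2 * r / n := by push_cast; ring
    rw [e]
    ring
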